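/- Let $(c_i)_{i\ge 1}$ be a sequence of numbers with $0<c_i<1$, and let $E\subset[0,1]$ be the corresponding middle interval Cantor set: $E=\bigcap_n E_n$, where $E_0=[0,1]$ and $E_i$ is obtained from $E_{i-1}$ by removing from each of its $2^{i-1}$ component intervals $I$ the concentric open interval of length $c_i|I|$. A map $f:X\to Y$ between metric spaces is called quasisymmetric if it is injective and there is a homeomorphism $\eta:[0,\infty)\to[0,\infty)$ such that, for all distinct $x,y,z\in X$ and all $t>0$, $d(x,y)\le t\,d(y,z)$ implies $d(f(x),f(y))\le\eta(t)\,d(f(y),f(z))$. The conformal dimension of $X$ is the infimum of the Hausdorff dimensions $\dim_H f(X)$ over all quasisymmetric maps $f$ from $X$ to a metric space, and $X$ is minimal for conformal dimension if this infimum equals $\dim_H X$. A metric space $X$ is uniformly perfect if there is a constant $C\ge 1$ such that, for all $x\in X$ and $r>0$, $X\setminus B(x,r)\ne\emptyset$ implies $B(x,r)\setminus B(x,r/C)\ne\emptyset$, where $B(x,r)$ denotes the open ball. Then the following hold. (i) If $E$ (with the Euclidean metric) is uniformly perfect, then $E$ is minimal for conformal dimension if and only if $\dim_H E=1$. (ii)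 If $\dim_H E=1$, then $\dim_H f(E)\ge 1$ for every map $f:E\to Y$ into a metric space $Y$ that extends to a quasisymmetric map $F:X\to Y$ of some uniformly perfect metric space $X$ containing $E$ isometrically. -/

import Mathlib

open scoped ENNReal NNReal

universe u

/-- A map between metric spaces is quasisymmetric if it is injective (so that the quotients of
distances below are meaningful; continuity of the map and of its inverse is then automatic) and
there is a homeomorphism `η` of `[0, ∞)` onto itself such that for all distinct triples
`x, y, z` and all `t > 0`, `d(x,y) / d(y,z) ≤ t` implies `d(f x, f y) / d(f y, f z) ≤ η t`. -/
def IsQuasisymmetric {X Y : Type*} [MetricSpace X] [MetricSpace Y] (f : X → Y) : Prop :=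
  Function.Injective f ∧
    ∃ η : ℝ≥0 ≃ₜ ℝ≥0, ∀ x y z : X, x ≠ y → y ≠ z → x ≠ z → ∀ t : ℝ≥0, 0 < t →
      dist x y / dist y z ≤ (t : ℝ) → dist (f x) (f y) / dist (f y) (f z) ≤ (η t : ℝ)

/-- The conformal dimension of a metric space: the infimum of the Hausdorff dimensions of its
quasisymmetric images. (Every image carries its metric back to `X`, so that it is enough to let the
targets range over the universe of `X`.) -/
noncomputable def conformalDim (X : Type u) [MetricSpace X] : ℝ≥0∞ :=
  sInf {d : ℝ≥0∞ | ∃ (Y : Type u) (_ : MetricSpace Y) (f : X → Y),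
    IsQuasisymmetric f ∧ d = dimH (Set.range f)}

/-- A metric space is minimal for conformal dimension if its conformal dimension equals its
Hausdorff dimension. -/
def IsMinimalForConformalDim (X : Type*) [MetricSpace X] : Prop :=
  conformalDim X = dimH (Set.univ : Set X)

/-- A metric space is uniformly perfect if there is `C ≥ 1` such that for all `x` and `r > 0`, if
`X \ B(x, r)` is nonempty then so is `B(x, r) \ B(x, r / C)`. -/
def IsUniformlyPerfect (X : Type*) [MetricSpace X] : Prop :=
  ∃ C : ℝ, 1 ≤ C ∧ ∀ (x : X) (r : ℝ), 0 < r →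
    (Set.univ \ Metric.ball x r).Nonempty → (Metric.ball x r \ Metric.ball x (r / C)).Nonempty

/-- The common length of the `2 ^ n` intervals left after `n` steps, when the step number `n + 1`
removes the open middle part of relative length `c n` from every interval. -/
noncomputable def cantorLength (c : ℕ → ℝ) : ℕ → ℝ
  | 0 => 1
  | n + 1 => (1 - c n) / 2 * cantorLength c n

/-- The left endpoints of the intervals left after `n` steps. An interval `[a, a + L]` with
`L = cantorLength c n` is replaced by `[a, a + (1 - c n) / 2 * L]` and
`[a + (1 + c n) / 2 * L, a + L]`. -/
noncomputable def cantorLeftEndpoints (c : ℕ → ℝ) : ℕ → Set ℝ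
  | 0 => {0}
  | n + 1 => cantorLeftEndpoints c n ∪
      (fun a => a + (1 + c n) / 2 * cantorLength c n) '' cantorLeftEndpoints c n

/-- The union of the closed intervals left after `n` steps, starting from `[0, 1]`. -/
noncomputable def cantorStage (c : ℕ → ℝ) (n : ℕ) : Set ℝ :=
  ⋃ a ∈ cantorLeftEndpoints c n, Set.Icc a (a + cantorLength c n)

/-- The set of the points of `[0, 1]` that are never removed. -/
noncomputable def middleIntervalCantorSet (c : ℕ → ℝ) : Set ℝ :=
  ⋂ n, cantorStage c n

/-- A middle interval Cantor set: each step removes from every remaining interval its open middle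
part, of a proportion strictly between `0` and `1` that depends only on the step. -/
def IsMiddleIntervalCantorSet (E : Set ℝ) : Prop :=
  ∃ c : ℕ → ℝ, (∀ i, 0 < c i ∧ c i < 1) ∧ E = middleIntervalCantorSet c

/-! Write `L_n` for the length of the intervals of level `n`, so that `2^n L_n = ∏_{j<n} (1 - c_j)`.
Covering by all intervals of one level, and spreading mass evenly over them, compares `dim E` with
the growth of `2^n L_n^s` (`dimH_middleCantor_le`, `le_dimH_middleCantor`).

Lower bound, for (ii) and for one half of (i). On a uniformly perfect space the distortion of a
quasisymmetric map is polynomial (`IsQuasisymmetric.exists_growth`). Let `D` be the distance between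
the images of the two ends of an interval. A gap that is short relative to its neighbouring
intervals has a relatively short image, and a long gap costs at most a power of `1/(1 - c_n)`; hence
`D(parent) ≤ (1+ε) (1-c_n)^{-N} (D(left) + D(right))` (`exists_image_split`). So `P_n D` with `P_n =
(1+ε)^n (2^n L_n)^{-N}` is a subadditive weight. Dimension one makes `2^n L_n` decay
subexponentially (`one_le_of_dimH_eq_one`), so `P_n` grows at an arbitrarily small exponential rate,
whereas `D` decays exponentially (`exists_image_decay`). Thus `P_n D ≤ const · D^s` for each `s <
1`, and the mass distribution principle `le_dimH_image_of_weight` gives dimension at least `s`.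

Upper bound, for the other half of (i). Uniform perfectness gives `L_{n+1} ≥ δ L_n`. If `d = dim E <
1`, integrate the density `ρ(dist(u, E))`, where `ρ(t) = exp(-∑_{L_j ≥ t} c_j)`. Since `ρ` is
monotone and doubling, two points of `E` at distance `r` acquire a distance comparable to `r ρ(r)`,
so the primitive is quasisymmetric on `E`. At level `n` it shrinks lengths by at least the factor
`(2^n L_n)^{2δ}`, a power of `2^{-n}` along infinitely many `n` because `d < 1`; the dimension drops
strictly (`dimH_deformation_lt`). -/

/-- The offset of the right child inside an interval of level `n`. -/
noncomputable def cantorShift (c : ℕ → ℝ) (n : ℕ) : ℝ := (1 + c n) / 2 * cantorLength c n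

/-- The interval of level `n` with left endpoint `a`. -/
noncomputable def cantorInterval (c : ℕ → ℝ) (n : ℕ) (a : ℝ) : Set ℝ :=
  Set.Icc a (a + cantorLength c n)

/-! ### Combinatorics of the construction intervals -/

section Geometry

variable {c : ℕ → ℝ}

theorem cantorLength_succ (c : ℕ → ℝ) (n : ℕ) :
    cantorLength c (n + 1) = (1 - c n) / 2 * cantorLength c n := rfl

theorem cantorLength_pos (hc : ∀ i, 0 < c i ∧ c i < 1) (n : ℕ) : 0 < cantorLength c n := by
  induction n with
  | zero => exact one_pos
  | succ n ih =>
    rw [cantorLength_succ]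
    have := (hc n).2
    exact mul_pos (by linarith) ih

theorem two_mul_cantorLength_succ (c : ℕ → ℝ) (n : ℕ) :
    2 * cantorLength c (n + 1) = (1 - c n) * cantorLength c n := by
  rw [cantorLength_succ]; ring

theorem cantorLength_succ_lt_half (hc : ∀ i, 0 < c i ∧ c i < 1) (n : ℕ) :
    2 * cantorLength c (n + 1) < cantorLength c n := by
  rw [two_mul_cantorLength_succ]
  nlinarith [mul_pos (hc n).1 (cantorLength_pos hc n)]

theorem cantorShift_add (c : ℕ → ℝ) (n : ℕ) :
    cantorShift c n + cantorLength c (n + 1) = cantorLength c n := by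
  rw [cantorLength_succ, cantorShift]; ring

theorem cantorShift_eq (c : ℕ → ℝ) (n : ℕ) :
    cantorShift c n = cantorLength c (n + 1) + c n * cantorLength c n := by
  rw [cantorLength_succ, cantorShift]; ring

theorem cantorLength_lt_shift (hc : ∀ i, 0 < c i ∧ c i < 1) (n : ℕ) :
    cantorLength c (n + 1) < cantorShift c n := by
  rw [cantorShift_eq]
  linarith [mul_pos (hc n).1 (cantorLength_pos hc n)]

theorem cantorLength_add_le (hc : ∀ i, 0 < c i ∧ c i < 1) (n m : ℕ) :
    2 ^ m * cantorLength c (n + m) ≤ cantorLength c n := by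
  induction m with
  | zero => simp
  | succ m ih =>
    have := cantorLength_succ_lt_half hc (n + m)
    rw [← add_assoc, pow_succ]
    have h2 : (0 : ℝ) < 2 ^ m := by positivity
    nlinarith

theorem cantorLength_antitone (hc : ∀ i, 0 < c i ∧ c i < 1) : Antitone (cantorLength c) :=
  antitone_nat_of_succ_le fun n => by
    linarith [cantorLength_succ_lt_half hc n, cantorLength_pos hc (n + 1)]

theorem cantorLength_le_pow (hc : ∀ i, 0 < c i ∧ c i < 1) (n : ℕ) :
    cantorLength c n ≤ (1 / 2) ^ n := by
  have := cantorLength_add_le hc 0 n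
  rw [zero_add] at this
  rw [one_div, inv_pow, le_inv_comm₀ (cantorLength_pos hc n) (by positivity),
    ← one_div, le_div_iff₀ (cantorLength_pos hc n)]
  exact this

theorem cantorLength_le_one (hc : ∀ i, 0 < c i ∧ c i < 1) (n : ℕ) : cantorLength c n ≤ 1 :=
  cantorLength_antitone hc (Nat.zero_le n)

theorem exists_cantorLength_lt (hc : ∀ i, 0 < c i ∧ c i < 1) {r : ℝ} (hr : 0 < r) :
    ∃ n, cantorLength c n < r := by
  obtain ⟨n, hn⟩ := exists_pow_lt_of_lt_one hr (by norm_num : (1 / 2 : ℝ) < 1)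
  exact ⟨n, (cantorLength_le_pow hc n).trans_lt hn⟩

theorem tendsto_cantorLength (hc : ∀ i, 0 < c i ∧ c i < 1) :
    Filter.Tendsto (cantorLength c) Filter.atTop (nhds 0) :=
  squeeze_zero (fun n => (cantorLength_pos hc n).le) (cantorLength_le_pow hc)
    (tendsto_pow_atTop_nhds_zero_of_lt_one (by norm_num) (by norm_num))

theorem exists_cantorLength_lt_le (hc : ∀ i, 0 < c i ∧ c i < 1) {r : ℝ} (hr : 0 < r)
    (hr1 : r ≤ 1) : ∃ n, cantorLength c (n + 1) < r ∧ r ≤ cantorLength c n := by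
  classical
  have hex := exists_cantorLength_lt hc hr
  have h0 : Nat.find hex ≠ 0 := by
    intro h
    have := Nat.find_spec hex
    rw [h] at this
    exact absurd hr1 (not_le.2 this)
  obtain ⟨k, hk⟩ := Nat.exists_eq_succ_of_ne_zero h0
  refine ⟨k, ?_, ?_⟩
  · have := Nat.find_spec hex
    rwa [hk] at this
  · have := Nat.find_min hex (m := k) (by omega)
    exact not_lt.1 this

theorem left_mem_succ {n : ℕ} {a : ℝ} (ha : a ∈ cantorLeftEndpoints c n) :
    a ∈ cantorLeftEndpoints c (n + 1) := Or.inl ha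

theorem shift_mem_succ {n : ℕ} {a : ℝ} (ha : a ∈ cantorLeftEndpoints c n) :
    a + cantorShift c n ∈ cantorLeftEndpoints c (n + 1) := Or.inr ⟨a, ha, rfl⟩

theorem mem_succ_iff {n : ℕ} {b : ℝ} : b ∈ cantorLeftEndpoints c (n + 1) ↔
    ∃ a ∈ cantorLeftEndpoints c n, b = a ∨ b = a + cantorShift c n := by
  constructor
  · rintro (h | ⟨a, ha, rfl⟩)
    · exact ⟨b, h, Or.inl rfl⟩
    · exact ⟨a, ha, Or.inr rfl⟩
  · rintro ⟨a, ha, rfl | rfl⟩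
    · exact left_mem_succ ha
    · exact shift_mem_succ ha

theorem left_mem_of_le {n m : ℕ} (h : n ≤ m) {a : ℝ} (ha : a ∈ cantorLeftEndpoints c n) :
    a ∈ cantorLeftEndpoints c m := by
  induction m, h using Nat.le_induction with
  | base => exact ha
  | succ m _ ih => exact left_mem_succ ih

theorem exists_parent (hc : ∀ i, 0 < c i ∧ c i < 1) {n : ℕ} {b : ℝ}
    (hb : b ∈ cantorLeftEndpoints c (n + 1)) : ∃ a ∈ cantorLeftEndpoints c n,
      a ≤ b ∧ b + cantorLength c (n + 1) ≤ a + cantorLength c n := by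
  have h1 := cantorShift_add c n
  have h2 := cantorLength_lt_shift hc n
  have h3 := cantorLength_pos hc (n + 1)
  obtain ⟨a, ha, rfl | rfl⟩ := mem_succ_iff.1 hb
  · exact ⟨b, ha, le_rfl, by linarith⟩
  · exact ⟨a, ha, by linarith, by linarith⟩

theorem exists_ancestor (hc : ∀ i, 0 < c i ∧ c i < 1) {m k : ℕ} (h : m ≤ k) {b : ℝ}
    (hb : b ∈ cantorLeftEndpoints c k) : ∃ a ∈ cantorLeftEndpoints c m,
      a ≤ b ∧ b + cantorLength c k ≤ a + cantorLength c m := by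
  induction k, h using Nat.le_induction generalizing b with
  | base => exact ⟨b, hb, le_rfl, le_rfl⟩
  | succ k _ ih =>
    obtain ⟨a, ha, h1, h2⟩ := exists_parent hc hb
    obtain ⟨a', ha', h3, h4⟩ := ih ha
    exact ⟨a', ha', h3.trans h1, h2.trans h4⟩

theorem left_bounds (hc : ∀ i, 0 < c i ∧ c i < 1) {n : ℕ} {a : ℝ}
    (ha : a ∈ cantorLeftEndpoints c n) : 0 ≤ a ∧ a + cantorLength c n ≤ 1 := by
  obtain ⟨b, hb, h1, h2⟩ := exists_ancestor hc (Nat.zero_le n) ha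
  obtain rfl : b = 0 := hb
  exact ⟨h1, by simpa [cantorLength] using h2⟩

theorem finite_left (c : ℕ → ℝ) (n : ℕ) : (cantorLeftEndpoints c n).Finite := by
  induction n with
  | zero => exact Set.finite_singleton 0
  | succ n ih => exact ih.union (ih.image _)

theorem ncard_left_le (c : ℕ → ℝ) (n : ℕ) : (cantorLeftEndpoints c n).ncard ≤ 2 ^ n := by
  induction n with
  | zero => exact (Set.ncard_singleton (0 : ℝ)).le
  | succ n ih =>
    refine (Set.ncard_union_le _ _).trans ?_
    have := Set.ncard_image_le (finite_left c n)
      (f := fun a => a + (1 + c n) / 2 * cantorLength c n)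
    rw [pow_succ]
    omega

theorem left_separated (hc : ∀ i, 0 < c i ∧ c i < 1) {n : ℕ} {a b : ℝ}
    (ha : a ∈ cantorLeftEndpoints c n) (hb : b ∈ cantorLeftEndpoints c n) (hab : a < b) :
    a + cantorLength c n < b := by
  induction n generalizing a b with
  | zero =>
    obtain rfl : a = 0 := ha
    obtain rfl : b = 0 := hb
    exact absurd hab (lt_irrefl _)
  | succ n ih =>
    have h1 := cantorShift_add c n
    have h2 := cantorLength_lt_shift hc n
    have h3 := cantorLength_pos hc (n + 1)
    obtain ⟨a', ha', h⟩ := mem_succ_iff.1 ha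
    obtain ⟨b', hb', h'⟩ := mem_succ_iff.1 hb
    rcases lt_trichotomy a' b' with hlt | rfl | hlt
    · have := ih ha' hb' hlt
      rcases h with rfl | rfl <;> rcases h' with rfl | rfl <;> linarith
    · rcases h with rfl | rfl <;> rcases h' with rfl | rfl <;> linarith
    · have := ih hb' ha' hlt
      rcases h with rfl | rfl <;> rcases h' with rfl | rfl <;> linarith

theorem left_eq_of_mem (hc : ∀ i, 0 < c i ∧ c i < 1) {n : ℕ} {a b x : ℝ}
    (ha : a ∈ cantorLeftEndpoints c n) (hb : b ∈ cantorLeftEndpoints c n)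
    (hxa : x ∈ cantorInterval c n a) (hxb : x ∈ cantorInterval c n b) : a = b := by
  rcases lt_trichotomy a b with h | h | h
  · have := left_separated hc ha hb h
    linarith [hxa.2, hxb.1]
  · exact h
  · have := left_separated hc hb ha h
    linarith [hxb.2, hxa.1]

theorem exists_interval {x : ℝ} (hx : x ∈ middleIntervalCantorSet c) (n : ℕ) :
    ∃ a ∈ cantorLeftEndpoints c n, x ∈ cantorInterval c n a := by
  have := Set.mem_iInter.1 hx n
  obtain ⟨a, ha, h⟩ := Set.mem_iUnion₂.1 this
  exact ⟨a, ha, h⟩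

theorem left_mem_middleCantor (hc : ∀ i, 0 < c i ∧ c i < 1) {n : ℕ} {a : ℝ}
    (ha : a ∈ cantorLeftEndpoints c n) : a ∈ middleIntervalCantorSet c := by
  refine Set.mem_iInter.2 fun m => ?_
  rcases le_total m n with h | h
  · obtain ⟨b, hb, h1, h2⟩ := exists_ancestor hc h ha
    exact Set.mem_biUnion hb ⟨h1, by linarith [cantorLength_pos hc n]⟩
  · exact Set.mem_biUnion (left_mem_of_le h ha) ⟨le_rfl, by linarith [cantorLength_pos hc m]⟩

theorem right_mem_middleCantor (hc : ∀ i, 0 < c i ∧ c i < 1) {n : ℕ} {a : ℝ}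
    (ha : a ∈ cantorLeftEndpoints c n) :
    a + cantorLength c n ∈ middleIntervalCantorSet c := by
  refine Set.mem_iInter.2 fun m => ?_
  rcases le_total m n with h | h
  · obtain ⟨b, hb, h1, h2⟩ := exists_ancestor hc h ha
    exact Set.mem_biUnion hb ⟨by linarith [cantorLength_pos hc n], h2⟩
  -- A right end is never removed: at each later level it is the right end of the rightmost
  -- descendant.
  · suffices ∃ b ∈ cantorLeftEndpoints c m, b + cantorLength c m = a + cantorLength c n by
      obtain ⟨b, hb, h⟩ := this
      exact Set.mem_biUnion hb ⟨by linarith [cantorLength_pos hc m], h.ge⟩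
    induction m, h using Nat.le_induction with
    | base => exact ⟨a, ha, rfl⟩
    | succ m _ ih =>
      obtain ⟨b, hb, h⟩ := ih
      exact ⟨_, shift_mem_succ hb, by linarith [cantorShift_add c m]⟩

theorem zero_mem_left (c : ℕ → ℝ) : (0 : ℝ) ∈ cantorLeftEndpoints c 0 := rfl

theorem zero_mem_middleCantor (hc : ∀ i, 0 < c i ∧ c i < 1) : (0 : ℝ) ∈ middleIntervalCantorSet c :=
  left_mem_middleCantor hc (zero_mem_left c)

theorem middleCantor_subset (c : ℕ → ℝ) : middleIntervalCantorSet c ⊆ Set.Icc 0 1 := by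
  intro x hx
  obtain ⟨a, ha, h⟩ := exists_interval hx 0
  obtain rfl : a = 0 := ha
  simpa [cantorInterval, cantorLength] using h

theorem isCompact_middleCantor (c : ℕ → ℝ) : IsCompact (middleIntervalCantorSet c) := by
  refine isCompact_Icc.of_isClosed_subset (isClosed_iInter fun n => ?_) (middleCantor_subset c)
  exact (finite_left c n).isClosed_biUnion fun a _ => isClosed_Icc

/-- The level-`n` intervals are finitely many, closed and disjoint, so each traces a relatively open
set on the Cantor set. This is what lets compactness act on countable covers by intervals. -/
theorem exists_open_interval (hc : ∀ i, 0 < c i ∧ c i < 1) {n : ℕ} {a : ℝ}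
    (ha : a ∈ cantorLeftEndpoints c n) : ∃ U : Set ℝ, IsOpen U ∧ cantorInterval c n a ⊆ U ∧
      U ∩ middleIntervalCantorSet c ⊆ cantorInterval c n a := by
  refine ⟨(⋃ b ∈ cantorLeftEndpoints c n \ {a}, cantorInterval c n b)ᶜ, ?_, ?_, ?_⟩
  · exact (((finite_left c n).subset Set.sdiff_subset).isClosed_biUnion
      fun a _ => isClosed_Icc).isOpen_compl
  · intro x hx h
    simp only [Set.mem_iUnion] at h
    obtain ⟨b, hb, hxb⟩ := h
    exact hb.2 (left_eq_of_mem hc hb.1 ha hxb hx)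
  · rintro x ⟨hx, hxE⟩
    obtain ⟨b, hb, hxb⟩ := exists_interval hxE n
    by_cases hba : b = a
    · rwa [← hba]
    · exact absurd (Set.mem_iUnion₂.2 ⟨b, ⟨hb, hba⟩, hxb⟩) hx

theorem interval_subset_or (hc : ∀ i, 0 < c i ∧ c i < 1) {n k : ℕ} (h : n + 1 ≤ k) {a b : ℝ}
    (ha : a ∈ cantorLeftEndpoints c n) (hb : b ∈ cantorLeftEndpoints c k)
    (hba : b ∈ cantorInterval c n a) :
    cantorInterval c k b ⊆ cantorInterval c (n + 1) a ∨
      cantorInterval c k b ⊆ cantorInterval c (n + 1) (a + cantorShift c n) := by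
  obtain ⟨b', hb', h1, h2⟩ := exists_ancestor hc h hb
  have h3 := cantorLength_pos hc k
  have h4 := cantorLength_pos hc (n + 1)
  have h5 := cantorShift_add c n
  have h6 := cantorLength_lt_shift hc n
  obtain ⟨a', ha', h'⟩ := mem_succ_iff.1 hb'
  have : a' = a := by
    refine left_eq_of_mem hc ha' ha (x := b) ?_ hba
    rcases h' with rfl | rfl
    · exact ⟨h1, by linarith⟩
    · exact ⟨by linarith, by linarith⟩
  subst this
  rcases h' with rfl | rfl
  · exact Or.inl (Set.Icc_subset_Icc h1 h2)
  · exact Or.inr (Set.Icc_subset_Icc h1 h2)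

theorem interval_subset_children (hc : ∀ i, 0 < c i ∧ c i < 1) {n : ℕ} {a x : ℝ}
    (ha : a ∈ cantorLeftEndpoints c n) (hx : x ∈ middleIntervalCantorSet c)
    (hxa : x ∈ cantorInterval c n a) : x ∈ cantorInterval c (n + 1) a ∨
      x ∈ cantorInterval c (n + 1) (a + cantorShift c n) := by
  obtain ⟨b, hb, hxb⟩ := exists_interval hx (n + 1)
  obtain ⟨a', ha', h'⟩ := mem_succ_iff.1 hb
  have h4 := cantorLength_pos hc (n + 1)
  have h5 := cantorShift_add c n
  have h6 := cantorLength_lt_shift hc n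
  have : a' = a := by
    refine left_eq_of_mem hc ha' ha ?_ hxa
    rcases h' with rfl | rfl
    · exact ⟨hxb.1, by linarith [hxb.2]⟩
    · exact ⟨by linarith [hxb.1], by linarith [hxb.2]⟩
  subst this
  rcases h' with rfl | rfl
  · exact Or.inl hxb
  · exact Or.inr hxb

end Geometry

/-! ### Mass distribution principle for subadditive weights -/

section MassDistribution

open MeasureTheory

variable {c : ℕ → ℝ}

/-- Subadditivity passes to every finite cover by intervals of the construction. Either the interval
itself belongs to the family, or each member lies in exactly one child, and the two subfamilies
cover the children. The number `d` bounds how many levels deeper the family reaches, which makes the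
induction terminate. -/
theorem weight_le_sum (hc : ∀ i, 0 < c i ∧ c i < 1) {W : ℕ → ℝ → ℝ≥0∞}
    (hW : ∀ n, ∀ a ∈ cantorLeftEndpoints c n,
      W n a ≤ W (n + 1) a + W (n + 1) (a + cantorShift c n))
    {ι : Type*} (p : ι → ℕ × ℝ) (d : ℕ) :
    ∀ (n : ℕ) (a : ℝ) (F : Finset ι), a ∈ cantorLeftEndpoints c n →
      (∀ i ∈ F, (p i).2 ∈ cantorLeftEndpoints c (p i).1 ∧ n ≤ (p i).1 ∧ (p i).1 ≤ n + d ∧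
        cantorInterval c (p i).1 (p i).2 ⊆ cantorInterval c n a) →
      (∀ x ∈ middleIntervalCantorSet c, x ∈ cantorInterval c n a →
        ∃ i ∈ F, x ∈ cantorInterval c (p i).1 (p i).2) →
      W n a ≤ ∑ i ∈ F, W (p i).1 (p i).2 := by
  classical
  have key : ∀ (n : ℕ) (a : ℝ) (i : ι), a ∈ cantorLeftEndpoints c n →
      (p i).2 ∈ cantorLeftEndpoints c (p i).1 →
      cantorInterval c (p i).1 (p i).2 ⊆ cantorInterval c n a → (p i).1 = n → (p i).2 = a := by
    intro n a i ha hi hs h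
    rw [h] at hi hs
    have hmem : (p i).2 ∈ cantorInterval c n (p i).2 :=
      ⟨le_rfl, by linarith [cantorLength_pos hc n]⟩
    exact left_eq_of_mem hc hi ha hmem (hs hmem)
  induction d with
  | zero =>
    intro n a F ha hF hcov
    obtain ⟨i, hi, -⟩ := hcov a (left_mem_middleCantor hc ha)
      ⟨le_rfl, by linarith [cantorLength_pos hc n]⟩
    obtain ⟨h1, h2, h3, h4⟩ := hF i hi
    have hn : (p i).1 = n := by omega
    have := key n a i ha h1 h4 hn
    calc W n a = W (p i).1 (p i).2 := by rw [hn, this]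
      _ ≤ _ := Finset.single_le_sum (f := fun i => W (p i).1 (p i).2) (fun _ _ => zero_le) hi
  | succ d ih =>
    intro n a F ha hF hcov
    by_cases hex : ∃ i ∈ F, (p i).1 = n
    · obtain ⟨i, hi, hn⟩ := hex
      obtain ⟨h1, h2, h3, h4⟩ := hF i hi
      have := key n a i ha h1 h4 hn
      calc W n a = W (p i).1 (p i).2 := by rw [hn, this]
        _ ≤ _ := Finset.single_le_sum (f := fun i => W (p i).1 (p i).2) (fun _ _ => zero_le) hi
    push Not at hex
    have hpos := cantorLength_pos hc (n + 1)
    have hlt := cantorLength_lt_shift hc n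
    have hadd := cantorShift_add c n
    set F₀ := F.filter fun i => cantorInterval c (p i).1 (p i).2 ⊆ cantorInterval c (n + 1) a
    set F₁ := F.filter fun i => cantorInterval c (p i).1 (p i).2 ⊆
      cantorInterval c (n + 1) (a + cantorShift c n)
    have hleft : ∀ i, (p i).2 ∈ cantorInterval c (p i).1 (p i).2 := fun i =>
      ⟨le_rfl, by linarith [cantorLength_pos hc (p i).1]⟩
    have hdisj : Disjoint F₀ F₁ := by
      refine Finset.disjoint_left.2 fun i h0 h1 => ?_
      have h0' := ((Finset.mem_filter.1 h0).2 (hleft i)).2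
      have h1' := ((Finset.mem_filter.1 h1).2 (hleft i)).1
      linarith
    have hsplit : ∀ i ∈ F, i ∈ F₀ ∨ i ∈ F₁ := by
      intro i hi
      obtain ⟨h1, h2, h3, h4⟩ := hF i hi
      have h2' : n + 1 ≤ (p i).1 := by have := hex i hi; omega
      rcases interval_subset_or hc h2' ha h1 (h4 (hleft i)) with h | h
      · exact Or.inl (Finset.mem_filter.2 ⟨hi, h⟩)
      · exact Or.inr (Finset.mem_filter.2 ⟨hi, h⟩)
    have b0 : W (n + 1) a ≤ ∑ i ∈ F₀, W (p i).1 (p i).2 := by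
      refine ih (n + 1) a F₀ (left_mem_succ ha) ?_ ?_
      · intro i hi
        obtain ⟨hi, hs⟩ := Finset.mem_filter.1 hi
        obtain ⟨h1, h2, h3, h4⟩ := hF i hi
        exact ⟨h1, by have := hex i hi; omega, by omega, hs⟩
      · intro x hx hxa
        obtain ⟨i, hi, hxi⟩ := hcov x hx ⟨hxa.1, by linarith [hxa.2]⟩
        rcases hsplit i hi with h | h
        · exact ⟨i, h, hxi⟩
        · have := ((Finset.mem_filter.1 h).2 hxi).1
          linarith [hxa.2]
    have b1 : W (n + 1) (a + cantorShift c n) ≤ ∑ i ∈ F₁, W (p i).1 (p i).2 := by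
      refine ih (n + 1) _ F₁ (shift_mem_succ ha) ?_ ?_
      · intro i hi
        obtain ⟨hi, hs⟩ := Finset.mem_filter.1 hi
        obtain ⟨h1, h2, h3, h4⟩ := hF i hi
        exact ⟨h1, by have := hex i hi; omega, by omega, hs⟩
      · intro x hx hxa
        obtain ⟨i, hi, hxi⟩ := hcov x hx ⟨by linarith [hxa.1], by linarith [hxa.2]⟩
        rcases hsplit i hi with h | h
        · have := ((Finset.mem_filter.1 h).2 hxi).2
          linarith [hxa.1]
        · exact ⟨i, h, hxi⟩
    calc W n a ≤ _ := hW n a ha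
      _ ≤ _ := add_le_add b0 b1
      _ = ∑ i ∈ F₀ ∪ F₁, W (p i).1 (p i).2 := (Finset.sum_union hdisj).symm
      _ ≤ _ := Finset.sum_le_sum_of_subset
        (Finset.union_subset (Finset.filter_subset _ _) (Finset.filter_subset _ _))

/-- The least weight of an interval that contains the part of `s` in the Cantor set. -/
noncomputable def cylinderContent (c : ℕ → ℝ) (W : ℕ → ℝ → ℝ≥0∞) (s : Set ℝ) : ℝ≥0∞ :=
  ⨅ p : {p : ℕ × ℝ // p.2 ∈ cantorLeftEndpoints c p.1 ∧
    s ∩ middleIntervalCantorSet c ⊆ cantorInterval c p.1 p.2}, W p.1.1 p.1.2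

theorem cylinderContent_le {W : ℕ → ℝ → ℝ≥0∞} {s : Set ℝ} {n : ℕ} {a : ℝ}
    (ha : a ∈ cantorLeftEndpoints c n)
    (hs : s ∩ middleIntervalCantorSet c ⊆ cantorInterval c n a) :
    cylinderContent c W s ≤ W n a :=
  iInf_le (fun p : {p : ℕ × ℝ // p.2 ∈ cantorLeftEndpoints c p.1 ∧
    s ∩ middleIntervalCantorSet c ⊆ cantorInterval c p.1 p.2} => W p.1.1 p.1.2) ⟨(n, a), ha, hs⟩

theorem cylinderContent_eq_zero {W : ℕ → ℝ → ℝ≥0∞}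
    (hsmall : ∀ δ : ℝ≥0∞, 0 < δ → ∃ n, ∀ a ∈ cantorLeftEndpoints c n, W n a ≤ δ) {s : Set ℝ}
    (hs : (s ∩ middleIntervalCantorSet c).Subsingleton) : cylinderContent c W s = 0 := by
  refine le_antisymm (le_of_forall_gt fun δ hδ => ?_) zero_le
  obtain ⟨δ', h0, h1⟩ := exists_between hδ
  obtain ⟨n, hn⟩ := hsmall δ' h0
  refine lt_of_le_of_lt ?_ h1
  rcases hs.eq_empty_or_singleton with h | ⟨x, h⟩
  · have ha := left_mem_of_le (Nat.zero_le n) (zero_mem_left c)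
    exact (cylinderContent_le ha (by rw [h]; exact Set.empty_subset _)).trans (hn 0 ha)
  · have hx : x ∈ middleIntervalCantorSet c := by
      have : x ∈ s ∩ middleIntervalCantorSet c := by rw [h]; rfl
      exact this.2
    obtain ⟨a, ha, hxa⟩ := exists_interval hx n
    refine (cylinderContent_le ha ?_).trans (hn a ha)
    rw [h]
    exact Set.singleton_subset_iff.2 hxa

/-- Each set of the cover is enlarged to an interval of almost optimal weight; these intervals are
relatively open, so compactness leaves finitely many of them and the finite case applies. -/
theorem weight_le_tsum_content (hc : ∀ i, 0 < c i ∧ c i < 1) {W : ℕ → ℝ → ℝ≥0∞}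
    (hW : ∀ n, ∀ a ∈ cantorLeftEndpoints c n,
      W n a ≤ W (n + 1) a + W (n + 1) (a + cantorShift c n))
    (t : ℕ → Set ℝ) (ht : middleIntervalCantorSet c ⊆ ⋃ n, t n) :
    W 0 0 ≤ ∑' n, cylinderContent c W (t n) := by
  by_cases htop : ∃ n, cylinderContent c W (t n) = ∞
  · obtain ⟨n, hn⟩ := htop
    rw [ENNReal.tsum_eq_top_of_eq_top ⟨n, hn⟩]
    exact le_top
  push Not at htop
  refine ENNReal.le_of_forall_pos_le_add fun ε hε _ => ?_
  obtain ⟨δ, hδ, hsum⟩ := ENNReal.exists_pos_sum_of_countable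
    (ENNReal.coe_ne_zero.2 hε.ne') ℕ
  have hex : ∀ n, ∃ p : {p : ℕ × ℝ // p.2 ∈ cantorLeftEndpoints c p.1 ∧
      t n ∩ middleIntervalCantorSet c ⊆ cantorInterval c p.1 p.2},
      W p.1.1 p.1.2 < cylinderContent c W (t n) + δ n := fun n =>
    iInf_lt_iff.1 (ENNReal.lt_add_right (htop n) (ENNReal.coe_ne_zero.2 (hδ n).ne'))
  choose p hp using hex
  choose U hUo hIU hUI using fun n => exists_open_interval hc (p n).2.1
  have hcov : middleIntervalCantorSet c ⊆ ⋃ n, U n := by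
    intro x hx
    obtain ⟨n, hn⟩ := Set.mem_iUnion.1 (ht hx)
    exact Set.mem_iUnion.2 ⟨n, hIU n ((p n).2.2 ⟨hn, hx⟩)⟩
  obtain ⟨F, hF⟩ := (isCompact_middleCantor c).elim_finite_subcover U hUo hcov
  have h1 : W 0 0 ≤ ∑ i ∈ F, W (p i).1.1 (p i).1.2 := by
    refine weight_le_sum hc hW (fun i => (p i).1) (F.sup fun i => (p i).1.1) 0 0 F
      (zero_mem_left c) (fun i hi => ⟨(p i).2.1, Nat.zero_le _, ?_, ?_⟩) ?_
    · rw [zero_add]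
      exact Finset.le_sup (f := fun i => (p i).1.1) hi
    · have := left_bounds hc (p i).2.1
      refine Set.Icc_subset_Icc this.1 ?_
      simpa [cantorLength] using this.2
    · intro x hx _
      obtain ⟨i, hi, hxi⟩ := Set.mem_iUnion₂.1 (hF hx)
      exact ⟨i, hi, hUI i ⟨hxi, hx⟩⟩
  calc W 0 0 ≤ _ := h1
    _ ≤ ∑ i ∈ F, (cylinderContent c W (t i) + δ i) := Finset.sum_le_sum fun i _ => (hp i).le
    _ ≤ ∑' i, (cylinderContent c W (t i) + δ i) := ENNReal.sum_le_tsum F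
    _ = ∑' i, cylinderContent c W (t i) + ∑' i, (δ i : ℝ≥0∞) := ENNReal.tsum_add
    _ ≤ _ := by gcongr

/-- A set of positive diameter is covered by two intervals whose children are shorter than it. -/
theorem exists_cover_two (hc : ∀ i, 0 < c i ∧ c i < 1) {A : Set ℝ}
    (hA : A ⊆ middleIntervalCantorSet c) (hne : ¬ A.Subsingleton) :
    ∃ n, ∃ a ∈ cantorLeftEndpoints c n, ∃ b ∈ cantorLeftEndpoints c n,
      A ⊆ cantorInterval c n a ∪ cantorInterval c n b ∧
      ∀ p ∈ A, ∃ q ∈ A, cantorLength c (n + 1) ≤ 2 * |p - q| := by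
  have hbdd : Bornology.IsBounded A :=
    (Metric.isBounded_Icc (0 : ℝ) 1).subset (hA.trans (middleCantor_subset c))
  have hnt : A.Nontrivial := Set.not_subsingleton_iff.1 hne
  have hpos : 0 < Metric.diam A := by
    obtain ⟨x, hx, y, hy, hxy⟩ := hnt
    exact (dist_pos.2 hxy).trans_le (Metric.dist_le_diam_of_mem hbdd hx hy)
  have hle : Metric.diam A ≤ 1 := by
    refine Metric.diam_le_of_forall_dist_le zero_le_one fun x hx y hy => ?_
    have h1 := middleCantor_subset c (hA hx)
    have h2 := middleCantor_subset c (hA hy)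
    rw [Real.dist_eq, abs_le]
    exact ⟨by linarith [h1.1, h2.2], by linarith [h1.2, h2.1]⟩
  -- The level satisfies `L_{n+1} < diam A ≤ L_n`. A third interval strictly between the extreme
  -- ones that meet `A` would force the diameter above `L_n`.
  obtain ⟨n, h1, h2⟩ := exists_cantorLength_lt_le hc hpos hle
  set T := {a ∈ cantorLeftEndpoints c n | (A ∩ cantorInterval c n a).Nonempty}
  have hTf : T.Finite := (finite_left c n).subset (Set.sep_subset _ _)
  have hTne : T.Nonempty := by
    obtain ⟨x, hx⟩ := hnt.nonempty
    obtain ⟨a, ha, hxa⟩ := exists_interval (hA hx) n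
    exact ⟨a, ha, x, hx, hxa⟩
  obtain ⟨a, ha, hamin⟩ := hTf.exists_minimalFor id T hTne
  obtain ⟨b, hb, hbmax⟩ := hTf.exists_maximalFor id T hTne
  refine ⟨n, a, ha.1, b, hb.1, ?_, ?_⟩
  · intro x hx
    obtain ⟨e, he, hxe⟩ := exists_interval (hA hx) n
    have heT : e ∈ T := ⟨he, x, hx, hxe⟩
    have hae : a ≤ e := (le_total a e).elim id fun h => hamin heT h
    have heb : e ≤ b := (le_total e b).elim id fun h => hbmax heT h
    rcases hae.eq_or_lt with rfl | hae
    · exact Or.inl hxe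
    rcases heb.eq_or_lt with rfl | heb
    · exact Or.inr hxe
    exfalso
    obtain ⟨p, hp, hpa⟩ := ha.2
    obtain ⟨q, hq, hqb⟩ := hb.2
    have h3 := left_separated hc ha.1 he hae
    have h4 := left_separated hc he hb.1 heb
    have h5 := Metric.dist_le_diam_of_mem hbdd hq hp
    rw [Real.dist_eq] at h5
    have := le_abs_self (q - p)
    linarith [hpa.2, hqb.1]
  · intro p hp
    -- If all of `A` were within `L_{n+1} / 2` of `p`, its diameter would be at most `L_{n+1}`.
    by_contra! hq
    have : Metric.diam A ≤ cantorLength c (n + 1) := by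
      refine Metric.diam_le_of_forall_dist_le (cantorLength_pos hc _).le fun x hx y hy => ?_
      have h3 := hq x hx
      have h4 := hq y hy
      have h5 := dist_triangle_left x y p
      simp only [Real.dist_eq] at h5 ⊢
      linarith
    linarith

/-- The mass distribution principle for subadditive weights on the intervals of the
construction. -/
theorem le_dimH_image_of_weight (hc : ∀ i, 0 < c i ∧ c i < 1) {Y : Type*} [MetricSpace Y]
    (g : ℝ → Y) {W : ℕ → ℝ → ℝ}
    (hW : ∀ n, ∀ a ∈ cantorLeftEndpoints c n,
      W n a ≤ W (n + 1) a + W (n + 1) (a + cantorShift c n))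
    (hW0 : ∀ n, ∀ a ∈ cantorLeftEndpoints c n, 0 ≤ W n a) (hpos : 0 < W 0 0)
    (hsmall : ∀ δ : ℝ, 0 < δ → ∃ n, ∀ a ∈ cantorLeftEndpoints c n, W n a ≤ δ)
    {s C : ℝ} (hs : 0 ≤ s) (hC : 0 < C)
    (hdist : ∀ n, ∀ a ∈ cantorLeftEndpoints c n, ∀ p ∈ middleIntervalCantorSet c,
      p ∈ cantorInterval c n a → ∀ q ∈ middleIntervalCantorSet c,
      cantorLength c n ≤ 2 * |p - q| → W n a ≤ C * dist (g p) (g q) ^ s) :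
    ENNReal.ofReal s ≤ dimH (g '' middleIntervalCantorSet c) := by
  set E := middleIntervalCantorSet c with hE
  set V : ℕ → ℝ → ℝ≥0∞ := fun n a => ENNReal.ofReal (W n a) with hV
  have hVsub : ∀ n, ∀ a ∈ cantorLeftEndpoints c n,
      V n a ≤ V (n + 1) a + V (n + 1) (a + cantorShift c n) := by
    intro n a ha
    simp only [hV]
    rw [← ENNReal.ofReal_add (hW0 _ _ (left_mem_succ ha)) (hW0 _ _ (shift_mem_succ ha))]
    exact ENNReal.ofReal_le_ofReal (hW n a ha)
  have hVsmall : ∀ δ : ℝ≥0∞, 0 < δ → ∃ n, ∀ a ∈ cantorLeftEndpoints c n, V n a ≤ δ := by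
    intro δ hδ
    by_cases htop : δ = ∞
    · exact ⟨0, fun _ _ => htop ▸ le_top⟩
    obtain ⟨n, hn⟩ := hsmall δ.toReal (ENNReal.toReal_pos hδ.ne' htop)
    exact ⟨n, fun a ha => ENNReal.ofReal_le_of_le_toReal (hn a ha)⟩
  have h0 : cylinderContent c V ∅ = 0 :=
    cylinderContent_eq_zero hVsmall (by simp)
  set ν : OuterMeasure ℝ := OuterMeasure.ofFunction (cylinderContent c V) h0 with hν
  have hνE : V 0 0 ≤ ν E := by
    rw [hν, OuterMeasure.ofFunction_apply]
    exact le_iInf₂ fun t ht => weight_le_tsum_content hc hVsub t ht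
  -- The content of a set depends only on its part in `E`, so the outer measure does not see the
  -- complement.
  have hνc : ν Eᶜ = 0 :=
    le_antisymm ((OuterMeasure.ofFunction_le _).trans
      (cylinderContent_eq_zero hVsmall (by simp [hE])).le) zero_le
  -- The factor 4 counts the children of the two intervals that cover the preimage of `B` in `E`.
  set K : ℝ≥0∞ := 4 * ENNReal.ofReal C with hK
  have hbound : ∀ B : Set Y, OuterMeasure.map g ν B ≤ K * Metric.ediam B ^ s := by
    intro B
    rw [OuterMeasure.map_apply]
    set A := g ⁻¹' B
    have hA : ν A ≤ ν (A ∩ E) := by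
      calc ν A ≤ ν ((A ∩ E) ∪ Eᶜ) := ν.mono fun x hx => by
            by_cases hxE : x ∈ E
            · exact Or.inl ⟨hx, hxE⟩
            · exact Or.inr hxE
        _ ≤ _ := measure_union_le _ _
        _ = ν (A ∩ E) := by rw [hνc, add_zero]
    refine hA.trans ?_
    by_cases hsub : (A ∩ E).Subsingleton
    · refine (OuterMeasure.ofFunction_le _).trans ?_
      rw [cylinderContent_eq_zero hVsmall (hsub.anti Set.inter_subset_left)]
      exact zero_le
    obtain ⟨n, a, ha, b, hb, hcov, hq⟩ := exists_cover_two hc Set.inter_subset_right hsub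
    have hpiece : ∀ e ∈ cantorLeftEndpoints c (n + 1),
        ν (A ∩ E ∩ cantorInterval c (n + 1) e) ≤ ENNReal.ofReal C * Metric.ediam B ^ s := by
      intro e he
      refine (OuterMeasure.ofFunction_le _).trans ?_
      rcases (A ∩ E ∩ cantorInterval c (n + 1) e).eq_empty_or_nonempty with h | ⟨p, hp, hpe⟩
      · rw [h, h0]; exact zero_le
      refine (cylinderContent_le he fun x hx => hx.1.2).trans ?_
      obtain ⟨q, hqA, hpq⟩ := hq p hp
      refine (ENNReal.ofReal_le_ofReal (hdist _ e he p hp.2 hpe q hqA.2 hpq)).trans ?_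
      rw [ENNReal.ofReal_mul hC.le, ← ENNReal.ofReal_rpow_of_nonneg dist_nonneg hs, ← edist_dist]
      gcongr
      exact Metric.edist_le_ediam_of_mem hp.1 hqA.1
    have hsubset : A ∩ E ⊆ ((A ∩ E ∩ cantorInterval c (n + 1) a) ∪
        (A ∩ E ∩ cantorInterval c (n + 1) (a + cantorShift c n))) ∪
        ((A ∩ E ∩ cantorInterval c (n + 1) b) ∪
        (A ∩ E ∩ cantorInterval c (n + 1) (b + cantorShift c n))) := by
      intro x hx
      rcases hcov hx with h | h
      · rcases interval_subset_children hc ha hx.2 h with h | h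
        · exact Or.inl (Or.inl ⟨hx, h⟩)
        · exact Or.inl (Or.inr ⟨hx, h⟩)
      · rcases interval_subset_children hc hb hx.2 h with h | h
        · exact Or.inr (Or.inl ⟨hx, h⟩)
        · exact Or.inr (Or.inr ⟨hx, h⟩)
    refine (measure_mono hsubset).trans ((measure_union_le _ _).trans ?_)
    calc _ ≤ (ENNReal.ofReal C * Metric.ediam B ^ s + ENNReal.ofReal C * Metric.ediam B ^ s) +
          (ENNReal.ofReal C * Metric.ediam B ^ s + ENNReal.ofReal C * Metric.ediam B ^ s) :=
          add_le_add
            ((measure_union_le _ _).trans (add_le_add (hpiece _ (left_mem_succ ha))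
              (hpiece _ (shift_mem_succ ha))))
            ((measure_union_le _ _).trans (add_le_add (hpiece _ (left_mem_succ hb))
              (hpiece _ (shift_mem_succ hb))))
      _ = _ := by rw [hK]; ring
  have hKtop : K ≠ ∞ := ENNReal.mul_ne_top (by norm_num) ENNReal.ofReal_ne_top
  have hK0 : K ≠ 0 := mul_ne_zero (by norm_num) (ENNReal.ofReal_pos.2 hC).ne'
  borelize Y
  -- The bound `ν (g⁻¹ B) ≤ K diam(B)^s` holds for every `B`, so the scale 1 is arbitrary. It makes
  -- the pushed-forward outer measure at most `K` times the Hausdorff measure, which is therefore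
  -- nonzero on the image.
  have hle : OuterMeasure.map g ν ≤ OuterMeasure.mkMetric (K • fun r : ℝ≥0∞ => r ^ s) :=
    OuterMeasure.le_mkMetric _ _ 1 one_pos fun B _ => by
      simpa using hbound B
  rw [OuterMeasure.mkMetric_smul _ hKtop hK0] at hle
  have hfin := hle (g '' E)
  rw [smul_apply, OuterMeasure.map_apply] at hfin
  have hne : Measure.hausdorffMeasure s (g '' E) ≠ 0 := by
    intro hzero
    rw [Measure.hausdorffMeasure, ← OuterMeasure.coe_mkMetric] at hzero
    rw [hzero, smul_zero] at hfin
    have := hνE.trans ((ν.mono (Set.subset_preimage_image g E)).trans hfin)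
    exact absurd this (not_le.2 (ENNReal.ofReal_pos.2 hpos))
  have := le_dimH_of_hausdorffMeasure_ne_zero (d := s.toNNReal) (s := g '' E)
    (by rwa [Real.coe_toNNReal s hs])
  exact this

end MassDistribution

/-! ### Dimension estimates from the level lengths -/

section UpperBound

open MeasureTheory Filter

variable {c : ℕ → ℝ}

/-- An upper bound for the dimension of an image in terms of the diameters of the images of the
intervals of the construction. -/
theorem dimH_image_le_of_diam {Y : Type*} [MetricSpace Y]
    (g : ℝ → Y) {M : ℕ → ℝ} (hM0 : ∀ n, 0 ≤ M n) (hM : Tendsto M atTop (nhds 0))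
    (hg : ∀ n, ∀ a ∈ cantorLeftEndpoints c n, ∀ x ∈ middleIntervalCantorSet c,
      ∀ y ∈ middleIntervalCantorSet c, x ∈ cantorInterval c n a → y ∈ cantorInterval c n a →
      dist (g x) (g y) ≤ M n)
    {s : ℝ} (hs : 0 ≤ s) (hfreq : ∃ᶠ n in atTop, 2 ^ n * M n ^ s ≤ 1) :
    dimH (g '' middleIntervalCantorSet c) ≤ ENNReal.ofReal s := by
  borelize Y
  set E := middleIntervalCantorSet c
  have : ∀ n, Fintype (cantorLeftEndpoints c n) := fun n => (finite_left c n).fintype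
  set t : ∀ n : ℕ, cantorLeftEndpoints c n → Set Y :=
    fun n a => g '' (E ∩ cantorInterval c n a) with ht
  have hdiam : ∀ n i, Metric.ediam (t n i) ≤ ENNReal.ofReal (M n) := by
    intro n i
    refine Metric.ediam_le ?_
    rintro _ ⟨x, hx, rfl⟩ _ ⟨y, hy, rfl⟩
    rw [edist_dist]
    exact ENNReal.ofReal_le_ofReal (hg n i i.2 x hx.1 y hy.1 hx.2 hy.2)
  have hle := Measure.hausdorffMeasure_le_liminf_sum (l := atTop) s (g '' E)
    (fun n => ENNReal.ofReal (M n)) (by simpa using ENNReal.tendsto_ofReal hM) t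
    (Eventually.of_forall hdiam) (Eventually.of_forall fun n => by
      rintro _ ⟨x, hx, rfl⟩
      obtain ⟨a, ha, hxa⟩ := exists_interval hx n
      exact Set.mem_iUnion.2 ⟨⟨a, ha⟩, x, ⟨hx, hxa⟩, rfl⟩)
  have hsum : ∀ n, 2 ^ n * M n ^ s ≤ 1 → ∑ i, Metric.ediam (t n i) ^ s ≤ 1 := by
    intro n hn
    calc ∑ i, Metric.ediam (t n i) ^ s
        ≤ ∑ _i : cantorLeftEndpoints c n, ENNReal.ofReal (M n) ^ s :=
          Finset.sum_le_sum fun i _ => ENNReal.rpow_le_rpow (hdiam n i) hs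
      _ = (Fintype.card (cantorLeftEndpoints c n) : ℝ≥0∞) * ENNReal.ofReal (M n) ^ s := by
          simp
      _ ≤ 2 ^ n * ENNReal.ofReal (M n) ^ s := by
          gcongr
          have := ncard_left_le c n
          rw [← Nat.card_coe_set_eq, Nat.card_eq_fintype_card] at this
          exact_mod_cast this
      _ = ENNReal.ofReal (2 ^ n * M n ^ s) := by
          rw [ENNReal.ofReal_mul (by positivity), ENNReal.ofReal_rpow_of_nonneg (hM0 n) hs,
            ENNReal.ofReal_pow (by norm_num)]
          simp
      _ ≤ 1 := by
          rw [← ENNReal.ofReal_one]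
          exact ENNReal.ofReal_le_ofReal hn
  -- Infinitely many good levels suffice, because the Hausdorff measure is bounded by a lower limit
  -- over the covers.
  have hlim : liminf (fun n => ∑ i, Metric.ediam (t n i) ^ s) atTop ≤ 1 :=
    liminf_le_of_frequently_le' (hfreq.mono hsum)
  have hne : Measure.hausdorffMeasure s (g '' E) ≠ ∞ :=
    ne_top_of_le_ne_top ENNReal.one_ne_top (hle.trans hlim)
  exact dimH_le_of_hausdorffMeasure_ne_top (d := s.toNNReal) (by rwa [Real.coe_toNNReal s hs])

theorem dimH_middleCantor_le (hc : ∀ i, 0 < c i ∧ c i < 1) {s : ℝ} (hs : 0 ≤ s)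
    (hfreq : ∃ᶠ n in atTop, 2 ^ n * cantorLength c n ^ s ≤ 1) :
    dimH (middleIntervalCantorSet c) ≤ ENNReal.ofReal s := by
  have := dimH_image_le_of_diam (c := c) (id : ℝ → ℝ) (fun n => (cantorLength_pos hc n).le)
    (tendsto_cantorLength hc) (fun n a _ x _ y _ hx hy => ?_) hs hfreq
  · rwa [Set.image_id] at this
  · rw [id, id, Real.dist_eq, abs_le]
    exact ⟨by linarith [hx.1, hy.2], by linarith [hx.2, hy.1]⟩

/-- The weight here is the uniform one, `2^{-n}` on every interval of level `n`. -/
theorem le_dimH_middleCantor (hc : ∀ i, 0 < c i ∧ c i < 1) {s : ℝ} (hs : 0 ≤ s)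
    (hev : ∀ᶠ n in atTop, 1 ≤ 2 ^ n * cantorLength c n ^ s) :
    ENNReal.ofReal s ≤ dimH (middleIntervalCantorSet c) := by
  obtain ⟨N, hN⟩ := eventually_atTop.1 hev
  have hpos := cantorLength_pos hc
  -- This constant takes care of the levels before `N`, where `L_n ≥ L_N` and hence `C L_n^s ≥ 1 ≥
  -- 2^{-n}`.
  set C : ℝ := (cantorLength c N ^ s)⁻¹ with hC
  have hC0 : 0 < C := inv_pos.2 (Real.rpow_pos_of_pos (hpos N) s)
  have hC1 : 1 ≤ C := (one_le_inv₀ (Real.rpow_pos_of_pos (hpos N) s)).2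
    (Real.rpow_le_one (hpos N).le (cantorLength_le_one hc N) hs)
  have hle : ∀ n, (1 / 2 : ℝ) ^ n ≤ C * cantorLength c n ^ s := by
    intro n
    have hp := Real.rpow_pos_of_pos (hpos n) s
    rcases le_total N n with h | h
    · have h1 := hN n h
      have h2 : (1 / 2 : ℝ) ^ n ≤ cantorLength c n ^ s := by
        rw [one_div, inv_pow, inv_le_iff_one_le_mul₀' (by positivity)]
        exact h1
      nlinarith
    · have h1 : cantorLength c N ^ s ≤ cantorLength c n ^ s :=
        Real.rpow_le_rpow (hpos N).le (cantorLength_antitone hc h) hs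
      have h2 : (1 / 2 : ℝ) ^ n ≤ 1 := pow_le_one₀ (by norm_num) (by norm_num)
      have h3 : C * cantorLength c N ^ s = 1 :=
        inv_mul_cancel₀ (Real.rpow_pos_of_pos (hpos N) s).ne'
      nlinarith
  have := le_dimH_image_of_weight hc (id : ℝ → ℝ) (W := fun n _ => (1 / 2) ^ n)
    (fun n a _ => by rw [pow_succ]; linarith) (fun n a _ => by positivity) (by norm_num)
    (fun δ hδ => by
      obtain ⟨n, hn⟩ := exists_pow_lt_of_lt_one hδ (by norm_num : (1 / 2 : ℝ) < 1)
      exact ⟨n, fun _ _ => hn.le⟩) hs (C := C * 2 ^ s) (by positivity) ?_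
  · rwa [Set.image_id] at this
  · intro n a _ p _ _ q _ hpq
    refine (hle n).trans ?_
    rw [id, id, Real.dist_eq, mul_assoc, ← Real.mul_rpow (by norm_num) (abs_nonneg _)]
    gcongr
    exact (hpos n).le

end UpperBound

/-! ### Distortion of quasisymmetric maps -/

section Quasisymmetric

open Filter

/-- A continuous injection of the half-line is strictly monotone, and a decreasing one would be
bounded by its value at 0, hence not onto. -/
theorem strictMono_homeomorph_nnreal (η : ℝ≥0 ≃ₜ ℝ≥0) : StrictMono η := by
  rcases η.continuous.strictMono_of_inj η.injective with h | h
  · exact h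
  · exfalso
    obtain ⟨t, ht⟩ := η.surjective (η 0 + 1)
    have : η t ≤ η 0 := h.antitone (zero_le (a := t))
    rw [ht] at this
    exact absurd this (not_le.2 (lt_add_one _))

theorem homeomorph_nnreal_zero (η : ℝ≥0 ≃ₜ ℝ≥0) : η 0 = 0 := by
  obtain ⟨t, ht⟩ := η.surjective 0
  have : η 0 ≤ η t := (strictMono_homeomorph_nnreal η).monotone zero_le
  rw [ht] at this
  exact le_antisymm this zero_le

variable {X Y : Type*} [MetricSpace X] [MetricSpace Y] {F : X → Y}

/-- Continuity of `η` at 0, where it vanishes, in a form without quotients that also admits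
degenerate triples. -/
theorem IsQuasisymmetric.exists_small (hF : IsQuasisymmetric F) {ε : ℝ} (hε : 0 < ε) :
    ∃ τ : ℝ, 0 < τ ∧ ∀ x y z : X, y ≠ z → dist x y ≤ τ * dist y z →
      dist (F x) (F y) ≤ ε * dist (F y) (F z) := by
  obtain ⟨hinj, η, hη⟩ := hF
  have hcont : Tendsto η (nhds 0) (nhds 0) := by
    have := η.continuous.tendsto 0
    rwa [homeomorph_nnreal_zero] at this
  have hev : ∀ᶠ t in nhds (0 : ℝ≥0), (η t : ℝ) < ε := by
    have h := hcont.eventually (gt_mem_nhds (Real.toNNReal_pos.2 hε))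
    filter_upwards [h] with t ht
    exact (Real.lt_toNNReal_iff_coe_lt).1 ht
  obtain ⟨δ, hδ, hball⟩ := Metric.eventually_nhds_iff.1 hev
  -- The cap `1 / 2` excludes `x = z`, a triple to which the definition does not apply.
  refine ⟨min (δ / 2) (1 / 2), by positivity, fun x y z hyz hd => ?_⟩
  set τ := min (δ / 2) (1 / 2)
  have hτ : 0 < τ := by positivity
  have hyz' : 0 < dist y z := dist_pos.2 hyz
  have hFyz : 0 < dist (F y) (F z) := dist_pos.2 (hinj.ne hyz)
  rcases eq_or_ne x y with rfl | hxy
  · rw [dist_self]; positivity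
  have hxz : x ≠ z := by
    rintro rfl
    rw [dist_comm y x] at hd hyz'
    have : τ ≤ 1 / 2 := min_le_right _ _
    nlinarith
  have := hη x y z hxy hyz hxz τ.toNNReal (Real.toNNReal_pos.2 hτ)
    (by rw [Real.coe_toNNReal _ hτ.le]; exact (div_le_iff₀ hyz').2 hd)
  have h2 : (η τ.toNNReal : ℝ) < ε := by
    refine hball ?_
    rw [NNReal.dist_eq, Real.coe_toNNReal _ hτ.le, NNReal.coe_zero, sub_zero, abs_of_pos hτ]
    exact (min_le_left _ _).trans_lt (by linarith)
  exact (div_le_iff₀ hFyz).1 (this.trans h2.le)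

theorem IsQuasisymmetric.exists_bound (hF : IsQuasisymmetric F) {t : ℝ} (ht : 0 < t) :
    ∃ H : ℝ, 1 ≤ H ∧ ∀ x y z : X, y ≠ z → dist x y ≤ t * dist y z →
      dist (F x) (F y) ≤ H * dist (F y) (F z) := by
  obtain ⟨hinj, η, hη⟩ := hF
  -- The maximum with 1 settles the case `x = z`.
  refine ⟨max 1 (η t.toNNReal), le_max_left _ _, fun x y z hyz hd => ?_⟩
  have hyz' : 0 < dist y z := dist_pos.2 hyz
  have hFyz : 0 < dist (F y) (F z) := dist_pos.2 (hinj.ne hyz)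
  have h1 : (1 : ℝ) ≤ max 1 (η t.toNNReal : ℝ) := le_max_left _ _
  rcases eq_or_ne x y with rfl | hxy
  · rw [dist_self]; positivity
  rcases eq_or_ne x z with rfl | hxz
  · rw [dist_comm (F x) (F y)]
    exact le_mul_of_one_le_left dist_nonneg h1
  have := hη x y z hxy hyz hxz t.toNNReal (Real.toNNReal_pos.2 ht)
    (by rw [Real.coe_toNNReal _ ht.le]; exact (div_le_iff₀ hyz').2 hd)
  exact (div_le_iff₀ hFyz).1 (this.trans (le_max_right _ _))

/-- A quasisymmetric map of a uniformly perfect space has a distortion function of polynomial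
growth. -/
theorem IsQuasisymmetric.exists_growth (hF : IsQuasisymmetric F) (hX : IsUniformlyPerfect X) :
    ∃ A : ℝ, 1 ≤ A ∧ ∃ K : ℕ, ∀ x y z : X, y ≠ z → ∀ t : ℝ, 1 ≤ t → dist x y ≤ t * dist y z →
      dist (F x) (F y) ≤ A * t ^ K * dist (F y) (F z) := by
  obtain ⟨C, hC, hup⟩ := hX
  -- The factor 2 makes the ratio of successive radii exceed 1 even if `C = 1`.
  set b : ℝ := 2 * C with hb
  have hb2 : 2 ≤ b := by linarith
  obtain ⟨H, hH1, hH⟩ := hF.exists_bound (t := b * C) (by positivity)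
  -- Chaining through annuli: if `x` is at distance between `ρ` and `b ρ` from `y`, uniform
  -- perfectness supplies `w` at distance between `ρ / C` and `ρ`. Then `x` is at most `b C` times
  -- as far from `y` as `w` is, which costs one factor `H`, and `w` falls under the induction
  -- hypothesis.
  have claim : ∀ (y z : X), y ≠ z → ∀ (m : ℕ) (x : X), dist x y ≤ dist y z * b ^ m →
      dist (F x) (F y) ≤ H ^ (m + 1) * dist (F y) (F z) := by
    intro y z hyz m
    have hyz' : 0 < dist y z := dist_pos.2 hyz
    induction m with
    | zero =>
      intro x hx
      rw [zero_add, pow_one]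
      refine hH x y z hyz (hx.trans ?_)
      rw [pow_zero, mul_one]
      exact le_mul_of_one_le_left hyz'.le (by nlinarith)
    | succ m ih =>
      intro x hx
      rcases le_or_gt (dist x y) (dist y z * b ^ m) with h | h
      · refine (ih x h).trans ?_
        exact mul_le_mul_of_nonneg_right (pow_le_pow_right₀ hH1 (Nat.le_succ _)) dist_nonneg
      · set ρ := dist y z * b ^ m with hρ
        have hρ0 : 0 < ρ := by positivity
        obtain ⟨w, hw1, hw2⟩ := hup y ρ hρ0 ⟨x, Set.mem_univ _, by
          rw [Metric.mem_ball]; exact not_lt.2 h.le⟩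
        rw [Metric.mem_ball] at hw1 hw2
        rw [not_lt, div_le_iff₀ (by linarith)] at hw2
        have hwy : y ≠ w := by
          rintro rfl
          rw [dist_self, zero_mul] at hw2
          linarith
        have h3 : dist x y ≤ b * C * dist y w := by
          rw [dist_comm y w]
          calc dist x y ≤ dist y z * b ^ (m + 1) := hx
            _ = b * ρ := by rw [hρ]; ring
            _ ≤ b * (dist w y * C) := by gcongr
            _ = _ := by ring
        calc dist (F x) (F y) ≤ H * dist (F y) (F w) := hH x y w hwy h3
          _ = H * dist (F w) (F y) := by rw [dist_comm (F y)]
          _ ≤ H * (H ^ (m + 1) * dist (F y) (F z)) := by gcongr; exact ih w hw1.le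
          _ = _ := by ring
  -- With `H < b^K` and `b^m ≤ t < b^(m+1)`, the exponential bound `H^(m+2)` becomes `H^2 t^K`.
  obtain ⟨K, hK⟩ := pow_unbounded_of_one_lt H (by linarith : 1 < b)
  refine ⟨H ^ 2, one_le_pow₀ hH1, K, fun x y z hyz t ht hd => ?_⟩
  obtain ⟨m, hm1, hm2⟩ := exists_nat_pow_near ht (by linarith : 1 < b)
  have h1 := claim y z hyz (m + 1) x (hd.trans (by rw [mul_comm]; gcongr))
  refine h1.trans ?_
  gcongr
  calc H ^ (m + 1 + 1) = H ^ 2 * H ^ m := by ring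
    _ ≤ H ^ 2 * (b ^ K) ^ m := by gcongr
    _ = H ^ 2 * (b ^ m) ^ K := by rw [← pow_mul, ← pow_mul, mul_comm K m]
    _ ≤ H ^ 2 * t ^ K := by gcongr

end Quasisymmetric

/-! ### Subexponential decay of the total length in dimension one -/

section FullDimension

open Filter

variable {c : ℕ → ℝ}

theorem exists_pos_one_add_pow_le (N : ℕ) {b : ℝ} (hb : 1 < b) :
    ∃ ε : ℝ, 0 < ε ∧ (1 + ε) ^ N ≤ b := by
  have hcont : Tendsto (fun ε : ℝ => (1 + ε) ^ N) (nhds 0) (nhds 1) := by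
    have : Continuous fun ε : ℝ => (1 + ε) ^ N := by fun_prop
    simpa using this.tendsto 0
  have h1 : ∀ᶠ ε in nhdsWithin (0 : ℝ) (Set.Ioi 0), (1 + ε) ^ N < b :=
    (hcont.eventually (gt_mem_nhds hb)).filter_mono nhdsWithin_le_nhds
  obtain ⟨ε, h, h0⟩ := (h1.and self_mem_nhdsWithin).exists
  exact ⟨ε, h0, h.le⟩

/-- If `2^n L_n^{1/q} ≤ 1` happened infinitely often for some `q > 1`, the dimension would be at
most `1/q < 1`. Raising the opposite inequality to the power `q`, with `2^q = 2 (1 + δ)`, gives the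
claim for large `n`; `C` absorbs the other levels. -/
theorem one_le_of_dimH_eq_one (hc : ∀ i, 0 < c i ∧ c i < 1)
    (hdim : dimH (middleIntervalCantorSet c) = 1) {δ : ℝ} (hδ : 0 < δ) :
    ∃ C : ℝ, 0 < C ∧ ∀ n, 1 ≤ C * (1 + δ) ^ n * (2 ^ n * cantorLength c n) := by
  have hpos := cantorLength_pos hc
  set q : ℝ := 1 + Real.logb 2 (1 + δ) with hq
  have hq1 : 1 < q := by
    have := Real.logb_pos (b := 2) (by norm_num) (by linarith : 1 < 1 + δ)
    linarith
  have h2q : (2 : ℝ) ^ q = 2 * (1 + δ) := by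
    rw [hq, Real.rpow_add (by norm_num), Real.rpow_one,
      Real.rpow_logb (by norm_num) (by norm_num) (by linarith)]
  have hev : ∀ᶠ n in atTop, 1 < 2 ^ n * cantorLength c n ^ (1 / q) := by
    by_contra h
    have h' : ∃ᶠ n in atTop, 2 ^ n * cantorLength c n ^ (1 / q) ≤ 1 := by
      exact (Filter.not_eventually.1 h).mono fun n hn => not_lt.1 hn
    have h3 := dimH_middleCantor_le hc (by positivity : 0 ≤ 1 / q) h'
    rw [hdim, ENNReal.one_le_ofReal, le_div_iff₀ (by linarith)] at h3
    linarith
  have hev' : ∀ᶠ n in atTop, 1 ≤ (1 + δ) ^ n * (2 ^ n * cantorLength c n) := by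
    filter_upwards [hev] with n hn
    have h4 := Real.rpow_le_rpow zero_le_one hn.le (by linarith : 0 ≤ q)
    rw [Real.one_rpow, Real.mul_rpow (by positivity) (Real.rpow_nonneg (hpos n).le _),
      ← Real.rpow_mul (hpos n).le, one_div_mul_cancel (by linarith), Real.rpow_one,
      ← Real.rpow_natCast, ← Real.rpow_mul (by norm_num), mul_comm (n : ℝ) q,
      Real.rpow_mul (by norm_num), h2q, Real.rpow_natCast, mul_pow] at h4
    linarith
  obtain ⟨N, hN⟩ := eventually_atTop.1 hev'
  have hC1 : 1 ≤ (cantorLength c N)⁻¹ := (one_le_inv₀ (hpos N)).2 (cantorLength_le_one hc N)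
  refine ⟨(cantorLength c N)⁻¹, inv_pos.2 (hpos N), fun n => ?_⟩
  have h1 : 1 ≤ (1 + δ) ^ n := one_le_pow₀ (by linarith)
  have h2 : (1 : ℝ) ≤ 2 ^ n := one_le_pow₀ (by norm_num)
  rcases le_total N n with h | h
  · rw [mul_assoc]
    exact one_le_mul_of_one_le_of_one_le hC1 (hN n h)
  · calc (1 : ℝ) = (cantorLength c N)⁻¹ * 1 * (1 * cantorLength c N) := by
          rw [mul_one, one_mul, inv_mul_cancel₀ (hpos N).ne']
      _ ≤ _ := by
          have := hpos N
          gcongr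
          exact cantorLength_antitone hc h

end FullDimension

/-! ### Images of a Cantor set of dimension one -/

section FullDimension

open Filter

variable {c : ℕ → ℝ} {Y : Type*} [MetricSpace Y] {g : ℝ → Y}

theorem dist_image_endpoint_le (hc : ∀ i, 0 < c i ∧ c i < 1) {A : ℝ} {K : ℕ}
    (hA : ∀ x ∈ middleIntervalCantorSet c, ∀ y ∈ middleIntervalCantorSet c,
      ∀ z ∈ middleIntervalCantorSet c, y ≠ z → ∀ t : ℝ, 1 ≤ t → dist x y ≤ t * dist y z →
      dist (g x) (g y) ≤ A * t ^ K * dist (g y) (g z))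
    {n : ℕ} {a : ℝ} (ha : a ∈ cantorLeftEndpoints c n) {u : ℝ}
    (hu : u ∈ middleIntervalCantorSet c) (hua : u ∈ cantorInterval c n a) :
    dist (g u) (g a) ≤ A * dist (g a) (g (a + cantorLength c n)) := by
  have hpos := cantorLength_pos hc n
  have := hA u hu a (left_mem_middleCantor hc ha) _ (right_mem_middleCantor hc ha)
    (by linarith) 1 le_rfl (by
      rw [Real.dist_eq, Real.dist_eq, abs_of_nonneg (by linarith [hua.1]),
        abs_of_nonpos (by linarith)]
      linarith [hua.2])
  simpa using this

/-- Within a fixed number of levels an interval becomes so short, relative to its distance from a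
suitable end of its ancestor, that its image shrinks at least by half. -/
theorem exists_image_decay (hc : ∀ i, 0 < c i ∧ c i < 1) {A : ℝ} (hA1 : 1 ≤ A) {K : ℕ}
    (hA : ∀ x ∈ middleIntervalCantorSet c, ∀ y ∈ middleIntervalCantorSet c,
      ∀ z ∈ middleIntervalCantorSet c, y ≠ z → ∀ t : ℝ, 1 ≤ t → dist x y ≤ t * dist y z →
      dist (g x) (g y) ≤ A * t ^ K * dist (g y) (g z))
    (hsmall : ∀ ε : ℝ, 0 < ε → ∃ τ : ℝ, 0 < τ ∧ ∀ x ∈ middleIntervalCantorSet c,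
      ∀ y ∈ middleIntervalCantorSet c, ∀ z ∈ middleIntervalCantorSet c, y ≠ z →
      dist x y ≤ τ * dist y z → dist (g x) (g y) ≤ ε * dist (g y) (g z))
    (hinj : Set.InjOn g (middleIntervalCantorSet c)) :
    ∃ m : ℕ, 0 < m ∧ ∃ B : ℝ, 0 < B ∧ ∀ n, ∀ a ∈ cantorLeftEndpoints c n,
      dist (g a) (g (a + cantorLength c n)) ≤ B * (1 / 2) ^ (n / m) := by
  -- The image distance from `b` to the chosen end `q` is at most `2A` times that of the ancestor's
  -- ends; the factor `1/(4A)` turns this into `1/2`.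
  obtain ⟨τ, hτ, hτd⟩ := hsmall (1 / (4 * A)) (by positivity)
  obtain ⟨m, hm⟩ := exists_pow_lt_of_lt_one (by positivity : 0 < τ / 2)
    (by norm_num : (1 / 2 : ℝ) < 1)
  set B := 2 * A * dist (g 0) (g (0 + cantorLength c 0)) with hB
  have hpos := cantorLength_pos hc
  have hB0 : 0 < B := by
    have h1 : (0 : ℝ) ≠ 0 + cantorLength c 0 := by linarith [hpos 0]
    have := dist_pos.2 (hinj.ne (zero_mem_middleCantor hc)
      (right_mem_middleCantor hc (zero_mem_left c)) h1)
    positivity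
  refine ⟨m + 1, by omega, B, hB0, fun n => ?_⟩
  induction n using Nat.strong_induction_on with
  | _ n ih =>
  intro b hb
  have hbE := left_mem_middleCantor hc hb
  have hb'E := right_mem_middleCantor hc hb
  rcases lt_or_ge n (m + 1) with hn | hn
  · rw [Nat.div_eq_of_lt hn, pow_zero, mul_one]
    have hbd := left_bounds hc hb
    have h0 : cantorLength c 0 = 1 := rfl
    have h1 := dist_image_endpoint_le hc hA (zero_mem_left c) hbE
      ⟨hbd.1, by linarith [hpos n]⟩
    have h2 := dist_image_endpoint_le hc hA (zero_mem_left c) hb'E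
      ⟨by linarith [hpos n], by linarith⟩
    have := dist_triangle_right (g b) (g (b + cantorLength c n)) (g 0)
    rw [hB]
    linarith
  · obtain ⟨k, rfl⟩ := Nat.exists_eq_add_of_le' hn
    obtain ⟨a, ha, h1, h2⟩ := exists_ancestor hc (Nat.le_add_right k (m + 1)) hb
    have ihk := ih k (by omega) a ha
    have haE := left_mem_middleCantor hc ha
    have ha'E := right_mem_middleCantor hc ha
    have hlen : cantorLength c (k + (m + 1)) ≤ τ / 2 * cantorLength c k := by
      have h3 := cantorLength_add_le hc k (m + 1)
      have h4 : (2 : ℝ) ^ m * (1 / 2) ^ m = 1 := by rw [← mul_pow]; norm_num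
      have h5 := hpos (k + (m + 1))
      have h6 : 0 < (1 / 2 : ℝ) ^ m := by positivity
      calc cantorLength c (k + (m + 1))
          = (2 ^ m * cantorLength c (k + (m + 1))) * (1 / 2) ^ m := by
            rw [mul_right_comm, h4, one_mul]
        _ ≤ cantorLength c k * (1 / 2) ^ m := by
            gcongr
            refine le_trans ?_ h3
            gcongr
            · norm_num
            · omega
        _ ≤ cantorLength c k * (τ / 2) := by
            have := hpos k
            gcongr
        _ = _ := mul_comm _ _
    -- One of the two ends of the ancestor is at least half its length away from `b`.
    obtain ⟨q, hq, hbq, hqd⟩ : ∃ q ∈ middleIntervalCantorSet c,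
        cantorLength c k / 2 ≤ dist b q ∧
        dist (g a) (g q) ≤ dist (g a) (g (a + cantorLength c k)) := by
      rcases le_total (cantorLength c k / 2) (b - a) with h | h
      · refine ⟨a, haE, ?_, by rw [dist_self]; positivity⟩
        rw [Real.dist_eq]
        exact h.trans (le_abs_self _)
      · refine ⟨_, ha'E, ?_, le_rfl⟩
        rw [Real.dist_eq, abs_sub_comm]
        exact le_trans (by linarith) (le_abs_self _)
    have hbne : b ≠ q := by
      rintro rfl
      rw [dist_self] at hbq
      linarith [hpos k]
    have h3 := hτd _ hb'E b hbE q hq hbne (by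
      rw [Real.dist_eq, add_sub_cancel_left, abs_of_pos (hpos _)]
      nlinarith)
    have h4 := dist_image_endpoint_le hc hA ha hbE ⟨h1, by linarith [hpos (k + (m + 1))]⟩
    have h5 := dist_triangle (g b) (g a) (g q)
    have h6 : dist (g b) (g q) ≤ 2 * A * dist (g a) (g (a + cantorLength c k)) := by
      have : 0 ≤ dist (g a) (g (a + cantorLength c k)) := dist_nonneg
      nlinarith
    rw [Nat.add_div_right _ (by omega), pow_succ, dist_comm]
    calc _ ≤ _ := h3
      _ ≤ 1 / (4 * A) * (2 * A * dist (g a) (g (a + cantorLength c k))) := by gcongr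
      _ = 1 / 2 * dist (g a) (g (a + cantorLength c k)) := by field_simp; norm_num
      _ ≤ 1 / 2 * (B * (1 / 2) ^ (k / (m + 1))) := by gcongr
      _ = _ := by ring

/-- By the triangle inequality only the image of the gap must be compared with that of the left
child. A gap short relative to the child contributes at most a factor `ε`. Otherwise `u = 1/(1 -
c_n)` is bounded away from 1, and a fixed power of `u` dominates the polynomial distortion. -/
theorem exists_image_split (hc : ∀ i, 0 < c i ∧ c i < 1) {A : ℝ} (hA1 : 1 ≤ A) {K : ℕ}
    (hA : ∀ x ∈ middleIntervalCantorSet c, ∀ y ∈ middleIntervalCantorSet c,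
      ∀ z ∈ middleIntervalCantorSet c, y ≠ z → ∀ t : ℝ, 1 ≤ t → dist x y ≤ t * dist y z →
      dist (g x) (g y) ≤ A * t ^ K * dist (g y) (g z))
    (hsmall : ∀ ε : ℝ, 0 < ε → ∃ τ : ℝ, 0 < τ ∧ ∀ x ∈ middleIntervalCantorSet c,
      ∀ y ∈ middleIntervalCantorSet c, ∀ z ∈ middleIntervalCantorSet c, y ≠ z →
      dist x y ≤ τ * dist y z → dist (g x) (g y) ≤ ε * dist (g y) (g z))
    {ε : ℝ} (hε : 0 < ε) :
    ∃ N : ℕ, ∀ n, ∀ a ∈ cantorLeftEndpoints c n,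
      dist (g a) (g (a + cantorLength c n)) ≤ (1 + ε) * (1 - c n)⁻¹ ^ N *
        (dist (g a) (g (a + cantorLength c (n + 1))) +
          dist (g (a + cantorShift c n))
            (g (a + cantorShift c n + cantorLength c (n + 1)))) := by
  obtain ⟨τ, hτ, hτd⟩ := hsmall ε hε
  -- A long gap has `u ≥ 1 + τ/2`, so `u^M` absorbs the constant `1 + A 2^K`; the remaining `u^K`
  -- comes from the ratio of gap to child, which is at most `2u`.
  obtain ⟨M, hM⟩ := pow_unbounded_of_one_lt (1 + A * 2 ^ K) (by linarith : 1 < 1 + τ / 2)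
  refine ⟨K + M, fun n a ha => ?_⟩
  have hpos := cantorLength_pos hc n
  have hpos' := cantorLength_pos hc (n + 1)
  have h2 := two_mul_cantorLength_succ c n
  have hs := cantorShift_eq c n
  obtain ⟨hc0, hc1⟩ := hc n
  set u := (1 - c n)⁻¹ with hu
  have hu0 : (1 - c n) * u = 1 := mul_inv_cancel₀ (by linarith)
  have hu1 : 1 ≤ u := by
    rw [hu, one_le_inv₀ (by linarith)]
    linarith
  have haE := left_mem_middleCantor hc ha
  have hlE := right_mem_middleCantor hc (left_mem_succ ha)
  have hsE := left_mem_middleCantor hc (shift_mem_succ ha)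
  have hne : a + cantorLength c (n + 1) ≠ a := by linarith
  have hd1 : dist (a + cantorShift c n) (a + cantorLength c (n + 1)) = c n * cantorLength c n := by
    rw [Real.dist_eq, hs]
    have : 0 < c n * cantorLength c n := mul_pos hc0 hpos
    rw [abs_of_nonneg] <;> linarith
  have hd2 : dist (a + cantorLength c (n + 1)) a = cantorLength c (n + 1) := by
    rw [Real.dist_eq, add_sub_cancel_left, abs_of_pos hpos']
  obtain ⟨θ, hθ, hθ'⟩ : ∃ θ : ℝ, dist (g (a + cantorShift c n)) (g (a + cantorLength c (n + 1)))
      ≤ θ * dist (g (a + cantorLength c (n + 1))) (g a) ∧ 1 + θ ≤ (1 + ε) * u ^ (K + M) := by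
    rcases le_or_gt (c n * cantorLength c n) (τ * cantorLength c (n + 1)) with h | h
    · refine ⟨ε, hτd _ hsE _ hlE _ haE hne (by rw [hd1, hd2]; exact h), ?_⟩
      exact le_mul_of_one_le_right (by linarith) (one_le_pow₀ hu1)
    · refine ⟨A * (2 * u) ^ K, hA _ hsE _ hlE _ haE hne (2 * u) (by linarith) ?_, ?_⟩
      · rw [hd1, hd2]
        calc c n * cantorLength c n ≤ 1 * cantorLength c n := by gcongr
          _ = u * ((1 - c n) * cantorLength c n) := by
            rw [← mul_assoc, mul_comm u, hu0]
          _ = _ := by rw [← h2]; ring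
      · have h3 : τ / 2 * (1 - c n) < c n := by
          have : τ / 2 * (1 - c n) * cantorLength c n < c n * cantorLength c n := by
            calc _ = τ * cantorLength c (n + 1) := by linear_combination (-τ / 2) * h2
              _ < _ := h
          exact lt_of_mul_lt_mul_right this hpos.le
        have h4 : 1 + τ / 2 ≤ u := by
          have h5 : τ / 2 * ((1 - c n) * u) ≤ c n * u := by
            rw [← mul_assoc]; gcongr
          rw [hu0] at h5
          linarith
        have h6 : 1 ≤ u ^ K := one_le_pow₀ hu1
        calc 1 + A * (2 * u) ^ K = 1 + A * 2 ^ K * u ^ K := by rw [mul_pow]; ring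
          _ ≤ u ^ K + A * 2 ^ K * u ^ K := by gcongr
          _ = u ^ K * (1 + A * 2 ^ K) := by ring
          _ ≤ u ^ K * (1 + τ / 2) ^ M := by gcongr
          _ ≤ u ^ K * u ^ M := by gcongr
          _ = 1 * u ^ (K + M) := by rw [pow_add, one_mul]
          _ ≤ (1 + ε) * u ^ (K + M) := by gcongr; linarith
  have hend : a + cantorShift c n + cantorLength c (n + 1) = a + cantorLength c n := by
    rw [add_assoc, cantorShift_add]
  rw [hend]
  have ht := dist_triangle4 (g a) (g (a + cantorLength c (n + 1))) (g (a + cantorShift c n))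
    (g (a + cantorLength c n))
  rw [dist_comm (g (a + cantorLength c (n + 1))) (g (a + cantorShift c n))] at ht
  rw [dist_comm (g (a + cantorLength c (n + 1))) (g a)] at hθ
  have hpow : 1 ≤ (1 + ε) * u ^ (K + M) :=
    one_le_mul_of_one_le_of_one_le (by linarith) (one_le_pow₀ hu1)
  have e1 : 0 ≤ dist (g a) (g (a + cantorLength c (n + 1))) := dist_nonneg
  have e2 : 0 ≤ dist (g (a + cantorShift c n)) (g (a + cantorLength c n)) := dist_nonneg
  have e3 := mul_le_mul_of_nonneg_right hθ' e1
  have e4 := mul_le_mul_of_nonneg_right hpow e2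
  rw [mul_add]
  linarith

/-- A map with polynomially growing distortion does not lower the dimension of a middle interval
Cantor set of dimension one. -/
theorem one_le_dimH_image (hc : ∀ i, 0 < c i ∧ c i < 1)
    (hdim : dimH (middleIntervalCantorSet c) = 1) {A : ℝ} (hA1 : 1 ≤ A) {K : ℕ}
    (hA : ∀ x ∈ middleIntervalCantorSet c, ∀ y ∈ middleIntervalCantorSet c,
      ∀ z ∈ middleIntervalCantorSet c, y ≠ z → ∀ t : ℝ, 1 ≤ t → dist x y ≤ t * dist y z →
      dist (g x) (g y) ≤ A * t ^ K * dist (g y) (g z))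
    (hsmall : ∀ ε : ℝ, 0 < ε → ∃ τ : ℝ, 0 < τ ∧ ∀ x ∈ middleIntervalCantorSet c,
      ∀ y ∈ middleIntervalCantorSet c, ∀ z ∈ middleIntervalCantorSet c, y ≠ z →
      dist x y ≤ τ * dist y z → dist (g x) (g y) ≤ ε * dist (g y) (g z))
    (hinj : Set.InjOn g (middleIntervalCantorSet c)) :
    1 ≤ dimH (g '' middleIntervalCantorSet c) := by
  suffices H : ∀ s : ℝ, 0 < s → s < 1 →
      ENNReal.ofReal s ≤ dimH (g '' middleIntervalCantorSet c) by
    refine ENNReal.le_of_forall_nnreal_lt fun r hr => ?_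
    rcases eq_or_ne r 0 with rfl | h0
    · exact zero_le
    · have := H r (NNReal.coe_pos.2 (pos_iff_ne_zero.2 h0)) (by exact_mod_cast hr)
      rwa [ENNReal.ofReal_coe_nnreal] at this
  intro s hs0 hs1
  have hpos := cantorLength_pos hc
  obtain ⟨m, hm, B, hB, hdecay⟩ := exists_image_decay hc hA1 hA hsmall hinj
  set D : ℕ → ℝ → ℝ := fun n a => dist (g a) (g (a + cantorLength c n)) with hD
  have hD0 : ∀ n a, 0 ≤ D n a := fun n a => dist_nonneg
  set σ : ℝ := 2 ^ (1 - s) with hσ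
  have hσ1 : 1 < σ := Real.one_lt_rpow (by norm_num) (by linarith)
  -- The exponent `2 * m` is shared: one `(1+ε)^n` is explicit in `P n`, another bounds
  -- `(1+δ)^{Nn}`. So `P` gains at most a factor `σ` per block of `m` levels, exactly what `D^(1-s)`
  -- loses.
  obtain ⟨ε, hε, hεσ⟩ := exists_pos_one_add_pow_le (2 * m) hσ1
  obtain ⟨N, hN⟩ := exists_image_split hc hA1 hA hsmall hε
  obtain ⟨δ, hδ, hδε⟩ := exists_pos_one_add_pow_le N (by linarith : 1 < 1 + ε)
  obtain ⟨C, hC, hCn⟩ := one_le_of_dimH_eq_one hc hdim hδ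
  set P : ℕ → ℝ := fun n => (1 + ε) ^ n * ((2 ^ n * cantorLength c n)⁻¹) ^ N with hP
  have hP0 : ∀ n, 0 < P n := fun n => by
    have := hpos n
    positivity
  have hPsucc : ∀ n, P (n + 1) = P n * ((1 + ε) * (1 - c n)⁻¹ ^ N) := by
    intro n
    have : 2 ^ (n + 1) * cantorLength c (n + 1) = 2 ^ n * cantorLength c n * (1 - c n) := by
      rw [pow_succ, mul_assoc, two_mul_cantorLength_succ]; ring
    simp only [hP]
    rw [this, mul_inv, mul_pow, pow_succ]
    ring
  have hPle : ∀ n, P n ≤ C ^ N * σ ^ (n / m + 1) := by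
    intro n
    have h1 : (2 ^ n * cantorLength c n)⁻¹ ≤ C * (1 + δ) ^ n := by
      rw [inv_le_iff_one_le_mul₀ (by have := hpos n; positivity)]
      exact hCn n
    have h0 : 0 ≤ (2 ^ n * cantorLength c n)⁻¹ := by have := hpos n; positivity
    have h2 : n ≤ m * (n / m + 1) := by
      have := Nat.div_add_mod n m
      have := Nat.mod_lt n hm
      rw [mul_add, mul_one]
      omega
    calc P n ≤ (1 + ε) ^ n * (C * (1 + δ) ^ n) ^ N := by
          simp only [hP]
          gcongr
      _ = C ^ N * ((1 + ε) ^ n * ((1 + δ) ^ N) ^ n) := by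
          rw [mul_pow, ← pow_mul, ← pow_mul, mul_comm n N]; ring
      _ ≤ C ^ N * ((1 + ε) ^ n * (1 + ε) ^ n) := by gcongr
      _ = C ^ N * ((1 + ε) ^ 2) ^ n := by rw [← pow_mul, ← pow_add]; ring_nf
      _ ≤ C ^ N * ((1 + ε) ^ 2) ^ (m * (n / m + 1)) := by
          gcongr
          exact one_le_pow₀ (by linarith)
      _ = C ^ N * ((1 + ε) ^ (2 * m)) ^ (n / m + 1) := by rw [← pow_mul, ← pow_mul, mul_assoc]
      _ ≤ _ := by gcongr
  set C₂ : ℝ := C ^ N * σ * B ^ (1 - s) with hC₂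
  have hC₂0 : 0 < C₂ := by positivity
  have hWle : ∀ n, ∀ a ∈ cantorLeftEndpoints c n, P n * D n a ≤ C₂ * D n a ^ s := by
    intro n a ha
    have h1 : D n a ^ (1 - s) ≤ B ^ (1 - s) * (σ ^ (n / m))⁻¹ := by
      calc D n a ^ (1 - s) ≤ (B * (1 / 2) ^ (n / m)) ^ (1 - s) :=
            Real.rpow_le_rpow (hD0 n a) (hdecay n a ha) (by linarith)
        _ = _ := by
            rw [Real.mul_rpow hB.le (by positivity), hσ, one_div, inv_pow,
              Real.inv_rpow (by positivity), Real.rpow_pow_comm (by norm_num)]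
    have h2 : D n a = D n a ^ (1 - s) * D n a ^ s := by
      rw [← Real.rpow_add_of_nonneg (hD0 n a) (by linarith) hs0.le, sub_add_cancel,
        Real.rpow_one]
    calc P n * D n a = P n * (D n a ^ (1 - s) * D n a ^ s) := by rw [← h2]
      _ = P n * D n a ^ (1 - s) * D n a ^ s := by ring
      _ ≤ (C ^ N * σ ^ (n / m + 1)) * (B ^ (1 - s) * (σ ^ (n / m))⁻¹) * D n a ^ s := by
          have := Real.rpow_nonneg (hD0 n a) s
          have := Real.rpow_nonneg (hD0 n a) (1 - s)
          gcongr
          exact hPle n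
      _ = C₂ * (σ ^ (n / m) * (σ ^ (n / m))⁻¹) * D n a ^ s := by rw [hC₂, pow_succ]; ring
      _ = _ := by rw [mul_inv_cancel₀ (by positivity), mul_one]
  refine le_dimH_image_of_weight hc g (W := fun n a => P n * D n a) ?_
    (fun n a _ => mul_nonneg (hP0 n).le (hD0 n a)) ?_ ?_ hs0.le
    (C := C₂ * (2 * (A * 2 ^ K)) ^ s) (by positivity) ?_
  · intro n a ha
    simp only [hPsucc, ← mul_add]
    rw [mul_assoc (P n)]
    exact mul_le_mul_of_nonneg_left (hN n a ha) (hP0 n).le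
  · refine mul_pos (hP0 0) (dist_pos.2 (hinj.ne (zero_mem_middleCantor hc)
      (right_mem_middleCantor hc (zero_mem_left c)) ?_))
    linarith [hpos 0]
  · intro δ' hδ'
    have hhalf : (1 / 2 : ℝ) ^ s < 1 := Real.rpow_lt_one (by norm_num) (by norm_num) hs0
    have hCB : 0 < C₂ * B ^ s := by positivity
    obtain ⟨k, hk⟩ := exists_pow_lt_of_lt_one (div_pos hδ' hCB) hhalf
    refine ⟨m * k, fun a ha => (hWle _ a ha).trans ?_⟩
    have h1 := hdecay (m * k) a ha
    rw [Nat.mul_div_cancel_left k hm] at h1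
    calc C₂ * D (m * k) a ^ s ≤ C₂ * (B * (1 / 2) ^ k) ^ s := by
          have := hD0 (m * k) a
          gcongr
      _ = C₂ * B ^ s * ((1 / 2 : ℝ) ^ s) ^ k := by
          rw [Real.mul_rpow hB.le (by positivity), Real.rpow_pow_comm (by norm_num)]; ring
      _ ≤ C₂ * B ^ s * (δ' / (C₂ * B ^ s)) := by gcongr
      _ = δ' := by field_simp
  -- Both ends of the interval are within `2 |p - q|` of `p`, so distortion at `t = 2` bounds `D n
  -- a` by the image distance of `p` and `q`.
  · intro n a ha p hp hpa q hq hpq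
    refine (hWle n a ha).trans ?_
    rw [mul_assoc C₂, ← Real.mul_rpow (by positivity) dist_nonneg]
    have hL := hpos n
    have hne : p ≠ q := by
      rintro rfl
      rw [sub_self, abs_zero] at hpq
      linarith
    have h1 := hA a (left_mem_middleCantor hc ha) p hp q hq hne 2 (by norm_num) (by
      rw [Real.dist_eq, Real.dist_eq, abs_of_nonpos (by linarith [hpa.1])]
      linarith [hpa.2])
    have h2 := hA _ (right_mem_middleCantor hc ha) p hp q hq hne 2 (by norm_num) (by
      rw [Real.dist_eq, Real.dist_eq, abs_of_nonneg (by linarith [hpa.2])]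
      linarith [hpa.1])
    have h3 : D n a ≤ 2 * (A * 2 ^ K) * dist (g p) (g q) := by
      have := dist_triangle_right (g a) (g (a + cantorLength c n)) (g p)
      simp only [hD]
      linarith
    have := hD0 n a
    gcongr

end FullDimension

/-! ### The scale-dependent density -/

section Weight

open MeasureTheory Filter

variable {c : ℕ → ℝ}

/-- The sum of the removed proportions over those of the first `N` steps whose intervals have at
least the length `t`. -/
noncomputable def removedSum (c : ℕ → ℝ) (N : ℕ) (t : ℝ) : ℝ :=
  ∑ j ∈ Finset.range N, if t ≤ cantorLength c j then c j else 0

/-- A density that decreases to zero together with the scale `t`. -/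
noncomputable def scaleWeight (c : ℕ → ℝ) (t : ℝ) : ℝ := ⨅ N, Real.exp (-removedSum c N t)

theorem scaleWeight_le (c : ℕ → ℝ) (N : ℕ) (t : ℝ) :
    scaleWeight c t ≤ Real.exp (-removedSum c N t) :=
  ciInf_le ⟨0, by rintro _ ⟨n, rfl⟩; positivity⟩ N

theorem le_scaleWeight {b t : ℝ} (h : ∀ N, b ≤ Real.exp (-removedSum c N t)) :
    b ≤ scaleWeight c t := le_ciInf h

theorem scaleWeight_nonneg (c : ℕ → ℝ) (t : ℝ) : 0 ≤ scaleWeight c t :=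
  le_scaleWeight fun _ => by positivity

theorem scaleWeight_le_one (c : ℕ → ℝ) (t : ℝ) : scaleWeight c t ≤ 1 := by
  simpa [removedSum] using scaleWeight_le c 0 t

theorem removedSum_antitone (hc : ∀ i, 0 < c i ∧ c i < 1) (N : ℕ) :
    Antitone (removedSum c N) := by
  intro s t hst
  refine Finset.sum_le_sum fun j _ => ?_
  have := (hc j).1
  split_ifs <;> linarith

theorem scaleWeight_mono (hc : ∀ i, 0 < c i ∧ c i < 1) : Monotone (scaleWeight c) := by
  intro s t hst
  refine le_scaleWeight fun N => (scaleWeight_le c N s).trans ?_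
  have := removedSum_antitone hc N hst
  gcongr

/-- Lengths more than halve at each step, so at most one level has its length in `[t, 2t)`, and it
contributes less than 1. -/
theorem removedSum_le_double (hc : ∀ i, 0 < c i ∧ c i < 1) (N : ℕ) {t : ℝ} (ht : 0 < t) :
    removedSum c N t ≤ removedSum c N (2 * t) + 1 := by
  have h1 : removedSum c N t ≤ removedSum c N (2 * t) +
      ∑ j ∈ Finset.range N,
        if t ≤ cantorLength c j ∧ cantorLength c j < 2 * t then (1 : ℝ) else 0 := by
    rw [removedSum, removedSum, ← Finset.sum_add_distrib]
    refine Finset.sum_le_sum fun j _ => ?_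
    have := hc j
    split_ifs <;> grind
  refine h1.trans (add_le_add le_rfl ?_)
  rw [Finset.sum_boole]
  norm_cast
  refine Finset.card_le_one.2 fun i hi j hj => ?_
  simp only [Finset.mem_filter] at hi hj
  have key : ∀ i j : ℕ, i < j → t ≤ cantorLength c j → ¬ cantorLength c i < 2 * t := by
    intro i j hij h1 h2
    have h3 := cantorLength_antitone hc (Nat.succ_le_of_lt hij)
    have h4 := cantorLength_succ_lt_half hc i
    linarith
  rcases lt_trichotomy i j with h | h | h
  · exact absurd hi.2.2 (key i j h hj.2.1)
  · exact h
  · exact absurd hj.2.2 (key j i h hi.2.1)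

theorem scaleWeight_double (hc : ∀ i, 0 < c i ∧ c i < 1) {t : ℝ} (ht : 0 < t) :
    scaleWeight c (2 * t) ≤ 4 * scaleWeight c t := by
  suffices scaleWeight c (2 * t) / 4 ≤ scaleWeight c t by linarith
  refine le_scaleWeight fun N => ?_
  have h1 := removedSum_le_double hc N ht
  have h2 : Real.exp (-removedSum c N (2 * t)) ≤ 4 * Real.exp (-removedSum c N t) := by
    calc Real.exp (-removedSum c N (2 * t)) ≤ Real.exp (1 + -removedSum c N t) := by
          gcongr
          linarith
      _ = Real.exp 1 * Real.exp (-removedSum c N t) := Real.exp_add _ _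
      _ ≤ _ := by
          gcongr
          linarith [Real.exp_one_lt_d9]
  linarith [scaleWeight_le c N (2 * t)]

theorem scaleWeight_two_pow (hc : ∀ i, 0 < c i ∧ c i < 1) {t : ℝ} (ht : 0 < t) (m : ℕ) :
    scaleWeight c (2 ^ m * t) ≤ 4 ^ m * scaleWeight c t := by
  induction m with
  | zero => simp
  | succ m ih =>
    have := scaleWeight_double hc (t := 2 ^ m * t) (by positivity)
    rw [pow_succ', mul_assoc, pow_succ']
    linarith

/-- Above scale 1 no level is counted and the weight is at least 1; doubling carries positivity down
to every scale. -/
theorem scaleWeight_pos (hc : ∀ i, 0 < c i ∧ c i < 1) {t : ℝ} (ht : 0 < t) :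
    0 < scaleWeight c t := by
  obtain ⟨m, hm⟩ := pow_unbounded_of_one_lt t⁻¹ (by norm_num : (1 : ℝ) < 2)
  have h1 : 1 < 2 ^ m * t := by
    rwa [inv_lt_iff_one_lt_mul₀ ht] at hm
  have h2 : 1 ≤ scaleWeight c (2 ^ m * t) := by
    refine le_scaleWeight fun N => ?_
    have : removedSum c N (2 ^ m * t) = 0 := by
      refine Finset.sum_eq_zero fun j _ => if_neg (not_le.2 ?_)
      exact (cantorLength_le_one hc j).trans_lt h1
    rw [this, neg_zero, Real.exp_zero]
  have h3 := scaleWeight_two_pow hc ht m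
  have h4 : (0 : ℝ) < 4 ^ m := by positivity
  by_contra h
  nlinarith [not_lt.1 h]

theorem scaleWeight_cantorLength_le (hc : ∀ i, 0 < c i ∧ c i < 1) (n : ℕ) :
    scaleWeight c (cantorLength c n) ≤ Real.exp (-∑ j ∈ Finset.range n, c j) := by
  refine (scaleWeight_le c n _).trans_eq ?_
  congr 2
  refine Finset.sum_congr rfl fun j hj => if_pos ?_
  exact cantorLength_antitone hc (Finset.mem_range.1 hj).le

/-- The points of an interval of the construction that are close to the Cantor set are covered by
neighbourhoods of intervals of a later level. -/
theorem volume_near_descendants (hc : ∀ i, 0 < c i ∧ c i < 1) (l : ℝ) (m : ℕ) :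
    ∀ (n : ℕ) (a : ℝ), a ∈ cantorLeftEndpoints c n →
      volume {x : ℝ | ∃ b ∈ cantorLeftEndpoints c (n + m), b ∈ cantorInterval c n a ∧
        x ∈ Set.Icc (b - l) (b + 2 * l)} ≤ 2 ^ m * ENNReal.ofReal (3 * l) := by
  induction m with
  | zero =>
    intro n a ha
    have hsub : {x : ℝ | ∃ b ∈ cantorLeftEndpoints c (n + 0), b ∈ cantorInterval c n a ∧
        x ∈ Set.Icc (b - l) (b + 2 * l)} ⊆ Set.Icc (a - l) (a + 2 * l) := by
      rintro x ⟨b, hb, hba, hx⟩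
      have hpos := cantorLength_pos hc n
      obtain rfl : b = a := left_eq_of_mem (x := b) hc hb ha ⟨le_rfl, by rw [add_zero]; linarith⟩ hba
      exact hx
    refine (measure_mono hsub).trans ?_
    rw [Real.volume_Icc, pow_zero, one_mul]
    exact ENNReal.ofReal_le_ofReal (by linarith)
  | succ m ih =>
    intro n a ha
    have e : n + (m + 1) = n + 1 + m := by omega
    have hsub : {x : ℝ | ∃ b ∈ cantorLeftEndpoints c (n + (m + 1)), b ∈ cantorInterval c n a ∧
        x ∈ Set.Icc (b - l) (b + 2 * l)} ⊆
        {x : ℝ | ∃ b ∈ cantorLeftEndpoints c (n + 1 + m), b ∈ cantorInterval c (n + 1) a ∧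
          x ∈ Set.Icc (b - l) (b + 2 * l)} ∪
        {x : ℝ | ∃ b ∈ cantorLeftEndpoints c (n + 1 + m),
          b ∈ cantorInterval c (n + 1) (a + cantorShift c n) ∧
          x ∈ Set.Icc (b - l) (b + 2 * l)} := by
      rintro x ⟨b, hb, hba, hx⟩
      rw [e] at hb
      rcases interval_subset_children hc ha (left_mem_middleCantor hc hb) hba with h | h
      · exact Or.inl ⟨b, hb, h, hx⟩
      · exact Or.inr ⟨b, hb, h, hx⟩
    refine (measure_mono hsub).trans ((measure_union_le _ _).trans ?_)
    calc _ ≤ 2 ^ m * ENNReal.ofReal (3 * l) + 2 ^ m * ENNReal.ofReal (3 * l) :=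
          add_le_add (ih _ _ (left_mem_succ ha)) (ih _ _ (shift_mem_succ ha))
      _ = _ := by rw [pow_succ]; ring

/-- A point of the interval that is close to `E` is equally close to a point of `E` inside the
interval, hence lies in the neighbourhood of one of its `2^m` descendants, each neighbourhood having
length `3 L_{n+m}`. -/
theorem volume_near_le (hc : ∀ i, 0 < c i ∧ c i < 1) {n : ℕ} {a : ℝ}
    (ha : a ∈ cantorLeftEndpoints c n) (m : ℕ) :
    volume (cantorInterval c n a ∩
      {x | Metric.infDist x (middleIntervalCantorSet c) ≤ cantorLength c (n + m)}) ≤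
      ENNReal.ofReal (3 * (2 ^ m * cantorLength c (n + m))) := by
  set l := cantorLength c (n + m) with hl
  have hsub : cantorInterval c n a ∩ {x | Metric.infDist x (middleIntervalCantorSet c) ≤ l} ⊆
      {x : ℝ | ∃ b ∈ cantorLeftEndpoints c (n + m), b ∈ cantorInterval c n a ∧
        x ∈ Set.Icc (b - l) (b + 2 * l)} := by
    rintro x ⟨hxa, hx⟩
    obtain ⟨y, hyE, hxy⟩ := (isCompact_middleCantor c).exists_infDist_eq_dist
      ⟨0, zero_mem_middleCantor hc⟩ x
    have hx' : |x - y| ≤ l := by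
      rw [← Real.dist_eq, ← hxy]
      exact hx
    -- A nearest point outside the interval may be replaced by the end of the interval on its side.
    obtain ⟨z, hzE, hza, hxz⟩ : ∃ z ∈ middleIntervalCantorSet c, z ∈ cantorInterval c n a ∧
        |x - z| ≤ l := by
      have hpos := cantorLength_pos hc n
      rw [abs_le] at hx'
      rcases le_or_gt a y with h1 | h1
      · rcases le_or_gt y (a + cantorLength c n) with h2 | h2
        · exact ⟨y, hyE, ⟨h1, h2⟩, abs_le.2 hx'⟩
        · refine ⟨_, right_mem_middleCantor hc ha, ⟨by linarith, le_rfl⟩, abs_le.2 ?_⟩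
          constructor <;> linarith [hxa.1, hxa.2]
      · refine ⟨_, left_mem_middleCantor hc ha, ⟨le_rfl, by linarith⟩, abs_le.2 ?_⟩
        constructor <;> linarith [hxa.1, hxa.2]
    obtain ⟨b, hb, hzb⟩ := exists_interval hzE (n + m)
    refine ⟨b, hb, ?_, ?_⟩
    · obtain ⟨a', ha', h1, h2⟩ := exists_ancestor hc (Nat.le_add_right n m) hb
      obtain rfl : a' = a := left_eq_of_mem (x := z) hc ha' ha
        ⟨h1.trans hzb.1, hzb.2.trans h2⟩ hza
      exact ⟨h1, by linarith [cantorLength_pos hc (n + m)]⟩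
    · rw [abs_le] at hxz
      constructor <;> linarith [hzb.1, hzb.2]
  refine (measure_mono hsub).trans ((volume_near_descendants hc l m n a ha).trans_eq ?_)
  rw [mul_left_comm, ENNReal.ofReal_mul (by positivity : (0 : ℝ) ≤ 2 ^ m),
    ENNReal.ofReal_pow (by norm_num)]
  simp

theorem measurable_scaleWeight_infDist (hc : ∀ i, 0 < c i ∧ c i < 1) :
    Measurable fun x => scaleWeight c (Metric.infDist x (middleIntervalCantorSet c)) :=
  (scaleWeight_mono hc).measurable.comp (Metric.continuous_infDist_pt _).measurable

theorem intervalIntegrable_scaleWeight (hc : ∀ i, 0 < c i ∧ c i < 1) (x y : ℝ) :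
    IntervalIntegrable (fun x => scaleWeight c (Metric.infDist x (middleIntervalCantorSet c)))
      volume x y := by
  rw [intervalIntegrable_iff]
  refine Measure.integrableOn_of_bounded (M := 1) (by simp)
    (measurable_scaleWeight_infDist hc).aestronglyMeasurable (ae_of_all _ fun u => ?_)
  rw [Real.norm_eq_abs, abs_of_nonneg (scaleWeight_nonneg _ _)]
  exact scaleWeight_le_one _ _

/-- On half of an interval of the construction the density is comparable to its value at the
length of the interval. -/
theorem le_integral_interval (hc : ∀ i, 0 < c i ∧ c i < 1) {n : ℕ} {a : ℝ}
    (ha : a ∈ cantorLeftEndpoints c n) :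
    Real.exp (-6) * scaleWeight c (cantorLength c n) * (cantorLength c n / 2) ≤
      ∫ x in a..(a + cantorLength c n),
        scaleWeight c (Metric.infDist x (middleIntervalCantorSet c)) := by
  set E := middleIntervalCantorSet c
  set L := cantorLength c n with hL
  have hLpos : 0 < L := cantorLength_pos hc n
  set near : ℕ → Set ℝ := fun j => {x | Metric.infDist x E ≤ cantorLength c (n + j)}
  have hnear : ∀ j, MeasurableSet (near j) := fun j =>
    (isClosed_le (Metric.continuous_infDist_pt _) continuous_const).measurableSet
  -- `H` majorises the part of the removed sum that comes from levels `n` and later. Its integral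
  -- telescopes, since `c_k 2^j L_k = 2^j L_k - 2^(j+1) L_{k+1}` for `k = n + j`.
  set H : ℝ → ℝ≥0∞ := fun x =>
    ∑' j, (near j).indicator (fun _ => ENNReal.ofReal (c (n + j))) x with hH
  have hHm : Measurable H := Measurable.tsum fun j => measurable_const.indicator (hnear j)
  set I := Set.Ioc a (a + L)
  have hint : ∫⁻ x in I, H x ≤ ENNReal.ofReal (3 * L) := by
    rw [hH, lintegral_tsum fun j => (measurable_const.indicator (hnear j)).aemeasurable]
    refine ENNReal.tsum_le_of_sum_range_le fun N => ?_
    have hterm : ∀ j, ∫⁻ x in I, (near j).indicator (fun _ => ENNReal.ofReal (c (n + j))) x ≤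
        ENNReal.ofReal (3 * (2 ^ j * cantorLength c (n + j) -
          2 ^ (j + 1) * cantorLength c (n + (j + 1)))) := by
      intro j
      rw [lintegral_indicator_const (hnear j), Measure.restrict_apply (hnear j), Set.inter_comm]
      have h1 : volume (I ∩ near j) ≤ _ :=
        (measure_mono (Set.inter_subset_inter_left _ Set.Ioc_subset_Icc_self)).trans
          (volume_near_le hc ha j)
      refine (mul_le_mul_right h1 _).trans_eq ?_
      rw [← ENNReal.ofReal_mul (hc _).1.le]
      congr 1
      have h2 := two_mul_cantorLength_succ c (n + j)
      rw [pow_succ, ← add_assoc]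
      linear_combination (3 * 2 ^ j) * h2
    have hnn : ∀ j, 0 ≤ 3 * (2 ^ j * cantorLength c (n + j) -
          2 ^ (j + 1) * cantorLength c (n + (j + 1))) := by
      intro j
      have h2 := cantorLength_succ_lt_half hc (n + j)
      have h3 : (0 : ℝ) < 2 ^ j := by positivity
      rw [pow_succ, ← add_assoc]
      nlinarith
    calc _ ≤ ∑ j ∈ Finset.range N, ENNReal.ofReal (3 * (2 ^ j * cantorLength c (n + j) -
          2 ^ (j + 1) * cantorLength c (n + (j + 1)))) := Finset.sum_le_sum fun j _ => hterm j
      _ = ENNReal.ofReal (3 * (L - 2 ^ N * cantorLength c (n + N))) := by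
          rw [← ENNReal.ofReal_sum_of_nonneg fun j _ => hnn j, ← Finset.mul_sum,
            Finset.sum_range_sub' (fun j => 2 ^ j * cantorLength c (n + j))]
          simp [hL]
      _ ≤ _ := by
          refine ENNReal.ofReal_le_ofReal ?_
          have h2 := cantorLength_pos hc (n + N)
          have h3 : (0 : ℝ) < 2 ^ N := by positivity
          nlinarith
  -- Markov's inequality with threshold 6 against the integral bound `3L` leaves at least half of
  -- the interval.
  set bad : Set ℝ := {x | 6 ≤ H x} with hbad
  have hbadm : MeasurableSet bad := measurableSet_le measurable_const hHm
  have hbadv : volume (I ∩ bad) ≤ ENNReal.ofReal (L / 2) := by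
    have h1 := mul_meas_ge_le_lintegral (μ := volume.restrict I) hHm 6
    rw [Measure.restrict_apply hbadm, Set.inter_comm] at h1
    have h2 : (6 : ℝ≥0∞) * volume (I ∩ bad) ≤ 6 * ENNReal.ofReal (L / 2) := by
      refine (h1.trans hint).trans_eq ?_
      rw [← ENNReal.ofReal_ofNat, ← ENNReal.ofReal_mul (by norm_num)]
      congr 1
      ring
    exact (ENNReal.mul_le_mul_iff_right (by norm_num) (by norm_num)).1 h2
  set good := I \ bad with hgood
  have hIm : MeasurableSet I := measurableSet_Ioc
  have hgoodv : L / 2 ≤ volume.real good := by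
    have h1 : volume.real I ≤ volume.real (I ∩ bad) + volume.real good := by
      rw [measureReal_inter_add_sdiff hbadm (by simp [I])]
    have h2 : volume.real (I ∩ bad) ≤ L / 2 :=
      ENNReal.toReal_le_of_le_ofReal (by linarith) hbadv
    have h3 : volume.real I = L := by
      simp [I, hLpos.le]
    linarith
  have hlow : ∀ x ∈ good, Real.exp (-6) * scaleWeight c L ≤ scaleWeight c (Metric.infDist x E) := by
    intro x hx
    have hx6 : H x < 6 := not_le.1 hx.2
    refine le_scaleWeight fun N => ?_
    have hle : removedSum c N (Metric.infDist x E) ≤ ∑ j ∈ Finset.range n, c j + 6 := by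
      have h1 : removedSum c N (Metric.infDist x E) ≤ removedSum c (n + N) (Metric.infDist x E) :=
        Finset.sum_le_sum_of_subset_of_nonneg (Finset.range_mono (by omega)) fun j _ _ => by
          have := (hc j).1
          split_ifs <;> linarith
      have h2 : ∑ j ∈ Finset.range n, (if Metric.infDist x E ≤ cantorLength c j then c j else 0) ≤
          ∑ j ∈ Finset.range n, c j := Finset.sum_le_sum fun j _ => by
        have := (hc j).1
        split_ifs <;> linarith
      have h3 : ∑ j ∈ Finset.range N,
          (if Metric.infDist x E ≤ cantorLength c (n + j) then c (n + j) else 0) ≤ 6 := by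
        have h4 : ENNReal.ofReal (∑ j ∈ Finset.range N,
            (if Metric.infDist x E ≤ cantorLength c (n + j) then c (n + j) else 0)) ≤ H x := by
          rw [ENNReal.ofReal_sum_of_nonneg]
          · refine le_trans (Finset.sum_le_sum fun j _ => ?_) (ENNReal.sum_le_tsum (Finset.range N))
            by_cases h : Metric.infDist x E ≤ cantorLength c (n + j)
            · rw [if_pos h, Set.indicator_of_mem (show x ∈ near j from h)]
            · rw [if_neg h, ENNReal.ofReal_zero]; exact zero_le
          · intro j _
            have := (hc (n + j)).1
            split_ifs <;> linarith
        have h5 := h4.trans hx6.le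
        rwa [← ENNReal.ofReal_ofNat, ENNReal.ofReal_le_ofReal_iff (by norm_num)] at h5
      have h6 : removedSum c (n + N) (Metric.infDist x E) = _ :=
        Finset.sum_range_add (fun j => if Metric.infDist x E ≤ cantorLength c j then c j else 0) n N
      linarith
    calc Real.exp (-6) * scaleWeight c L
        ≤ Real.exp (-6) * Real.exp (-∑ j ∈ Finset.range n, c j) := by
          gcongr
          exact scaleWeight_cantorLength_le hc n
      _ = Real.exp (-(∑ j ∈ Finset.range n, c j + 6)) := by
          rw [← Real.exp_add]; ring_nf
      _ ≤ _ := by gcongr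
  have hintg := (intervalIntegrable_scaleWeight hc a (a + L)).1
  rw [intervalIntegral.integral_of_le (by linarith)]
  have hfin : volume good ≠ ∞ := ne_top_of_le_ne_top (by simp [I]) (measure_mono Set.sdiff_subset)
  calc _ ≤ Real.exp (-6) * scaleWeight c L * volume.real good := by
        have := scaleWeight_nonneg c L
        gcongr
    _ ≤ ∫ x in good, scaleWeight c (Metric.infDist x E) :=
        setIntegral_ge_of_const_le_real (hIm.diff hbadm) hfin hlow (hintg.mono_set Set.sdiff_subset)
    _ ≤ _ := setIntegral_mono_set hintg
        (ae_of_all _ fun x => scaleWeight_nonneg _ _)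
        (Filter.Eventually.of_forall Set.sdiff_subset)

end Weight

/-! ### The deformation that lowers the dimension -/

section Deformation

open MeasureTheory Filter

variable {c : ℕ → ℝ}

/-- The primitive of the density of the deformation. -/
noncomputable def cantorDeformation (c : ℕ → ℝ) (x : ℝ) : ℝ :=
  ∫ u in (0 : ℝ)..x, scaleWeight c (Metric.infDist u (middleIntervalCantorSet c))

theorem cantorDeformation_sub (hc : ∀ i, 0 < c i ∧ c i < 1) (x y : ℝ) :
    cantorDeformation c y - cantorDeformation c x =
      ∫ u in x..y, scaleWeight c (Metric.infDist u (middleIntervalCantorSet c)) :=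
  intervalIntegral.integral_interval_sub_left (intervalIntegrable_scaleWeight hc _ _)
    (intervalIntegrable_scaleWeight hc _ _)

theorem integral_scaleWeight_mono (hc : ∀ i, 0 < c i ∧ c i < 1) {x y u v : ℝ} (hxu : x ≤ u)
    (huv : u ≤ v) (hvy : v ≤ y) :
    ∫ w in u..v, scaleWeight c (Metric.infDist w (middleIntervalCantorSet c)) ≤
      ∫ w in x..y, scaleWeight c (Metric.infDist w (middleIntervalCantorSet c)) :=
  intervalIntegral.integral_mono_interval hxu huv hvy
    (ae_of_all _ fun _ => scaleWeight_nonneg _ _) (intervalIntegrable_scaleWeight hc _ _)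

theorem integral_scaleWeight_nonneg (c : ℕ → ℝ) {x y : ℝ} (hxy : x ≤ y) :
    0 ≤ ∫ w in x..y, scaleWeight c (Metric.infDist w (middleIntervalCantorSet c)) :=
  intervalIntegral.integral_nonneg hxy fun _ _ => scaleWeight_nonneg _ _

theorem dist_deformation_of_le (hc : ∀ i, 0 < c i ∧ c i < 1) {x y : ℝ} (hxy : x ≤ y) :
    dist (cantorDeformation c x) (cantorDeformation c y) =
      ∫ w in x..y, scaleWeight c (Metric.infDist w (middleIntervalCantorSet c)) := by
  rw [dist_comm, Real.dist_eq, cantorDeformation_sub hc,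
    abs_of_nonneg (integral_scaleWeight_nonneg c hxy)]

/-- Between two points of `E` the distance to `E` never exceeds their distance apart, and the weight
is monotone. -/
theorem dist_deformation_le (hc : ∀ i, 0 < c i ∧ c i < 1) {x y : ℝ}
    (hx : x ∈ middleIntervalCantorSet c) (hy : y ∈ middleIntervalCantorSet c) :
    dist (cantorDeformation c x) (cantorDeformation c y) ≤
      dist x y * scaleWeight c (dist x y) := by
  wlog hxy : x ≤ y generalizing x y
  · have := this hy hx (le_of_not_ge hxy)
    rwa [dist_comm, dist_comm x y]
  rw [dist_deformation_of_le hc hxy]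
  have hd : dist x y = y - x := by rw [dist_comm, Real.dist_eq, abs_of_nonneg (by linarith)]
  calc _ ≤ ∫ _w in x..y, scaleWeight c (dist x y) := by
        refine intervalIntegral.integral_mono_on hxy (intervalIntegrable_scaleWeight hc _ _)
          intervalIntegrable_const fun w hw => scaleWeight_mono hc ?_
        refine (Metric.infDist_le_dist_of_mem hx).trans ?_
        rw [hd, Real.dist_eq, abs_of_nonneg (by linarith [hw.1])]
        linarith [hw.2]
    _ = _ := by rw [intervalIntegral.integral_const, smul_eq_mul, hd]

/-- Let `r = |x - y|`. Either the midpoint is far from `E`, and the density is at least `ρ(r/16)` on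
a window around it; or a point of `E` lies near the midpoint, and an interval of length comparable
to `r` around that point fits between `x` and `y`. Doubling converts both bounds to scale `r`. -/
theorem exists_le_dist_deformation (hc : ∀ i, 0 < c i ∧ c i < 1) {δ : ℝ} (hδ : 0 < δ)
    (hlen : ∀ n, δ * cantorLength c n ≤ cantorLength c (n + 1)) :
    ∃ κ : ℝ, 0 < κ ∧ ∀ x ∈ middleIntervalCantorSet c, ∀ y ∈ middleIntervalCantorSet c,
      κ * (dist x y * scaleWeight c (dist x y)) ≤
        dist (cantorDeformation c x) (cantorDeformation c y) := by
  obtain ⟨m, hm⟩ := pow_unbounded_of_one_lt (4 / δ) (by norm_num : (1 : ℝ) < 2)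
  -- The first constant is `(1/8) · 4^{-4}`, from a window of length `r/8` and four doublings. In
  -- the second, `δ/8` is half the guaranteed relative length `δ/4`, and `m` doublings lead from `δ
  -- r/4` to at least `r`.
  set κ : ℝ := min (1 / 2048) (Real.exp (-6) * (δ / 8) / 4 ^ m) with hκ
  have hκ0 : 0 < κ := by positivity
  refine ⟨κ, hκ0, fun x hx y hy => ?_⟩
  wlog hxy : x ≤ y generalizing x y
  · have := this y hy x hx (le_of_not_ge hxy)
    rwa [dist_comm (cantorDeformation c x), dist_comm x y]
  rw [dist_deformation_of_le hc hxy]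
  have hd : dist x y = y - x := by rw [dist_comm, Real.dist_eq, abs_of_nonneg (by linarith)]
  rw [hd]
  set r := y - x with hr
  rcases hxy.eq_or_lt with hxy | hxy
  · have h0 : r = 0 := by rw [hr, hxy, sub_self]
    rw [h0, zero_mul, mul_zero]
    exact integral_scaleWeight_nonneg c hxy.le
  have hr0 : 0 < r := by linarith
  have hr1 : r ≤ 1 := by
    have h1 := middleCantor_subset c hx
    have h2 := middleCantor_subset c hy
    linarith [h1.1, h2.2]
  set z := (x + y) / 2 with hz
  rcases le_or_gt (r / 8) (Metric.infDist z (middleIntervalCantorSet c)) with h | h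
  · have h1 : r / 8 * scaleWeight c (r / 16) ≤ ∫ w in (z - r / 16)..(z + r / 16),
        scaleWeight c (Metric.infDist w (middleIntervalCantorSet c)) := by
      calc r / 8 * scaleWeight c (r / 16)
          = ∫ _w in (z - r / 16)..(z + r / 16), scaleWeight c (r / 16) := by
            rw [intervalIntegral.integral_const, smul_eq_mul]; ring
        _ ≤ _ := by
            refine intervalIntegral.integral_mono_on (by linarith) intervalIntegrable_const
              (intervalIntegrable_scaleWeight hc _ _) fun w hw => scaleWeight_mono hc ?_
            have h2 := Metric.infDist_le_infDist_add_dist (s := middleIntervalCantorSet c)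
              (x := z) (y := w)
            have h3 : dist z w ≤ r / 16 := by
              rw [Real.dist_eq, abs_le]
              constructor <;> linarith [hw.1, hw.2]
            linarith
    have h2 := scaleWeight_two_pow hc (by positivity : 0 < r / 16) 4
    rw [show (2 : ℝ) ^ 4 * (r / 16) = r by ring] at h2
    have h3 := integral_scaleWeight_mono hc (x := x) (y := y) (u := z - r / 16)
      (v := z + r / 16) (by linarith) (by linarith) (by linarith)
    have h4 : κ ≤ 1 / 2048 := min_le_left _ _
    have h5 := scaleWeight_nonneg c r
    calc κ * (r * scaleWeight c r) ≤ 1 / 2048 * (r * (4 ^ 4 * scaleWeight c (r / 16))) := by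
          gcongr
      _ = r / 8 * scaleWeight c (r / 16) := by ring
      _ ≤ _ := h1.trans h3
  · obtain ⟨e, he, hze⟩ := (Metric.infDist_lt_iff ⟨x, hx⟩).1 h
    rw [Real.dist_eq, abs_lt] at hze
    obtain ⟨n, hn1, hn2⟩ := exists_cantorLength_lt_le hc (by positivity : 0 < r / 4)
      (by linarith)
    obtain ⟨a, ha, hea⟩ := exists_interval he (n + 1)
    have hL : δ * (r / 4) ≤ cantorLength c (n + 1) :=
      (mul_le_mul_of_nonneg_left hn2 hδ.le).trans (hlen n)
    have h1 := le_integral_interval hc ha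
    have h3 := integral_scaleWeight_mono hc (x := x) (y := y) (u := a)
      (v := a + cantorLength c (n + 1)) (by linarith [hea.2])
      (by linarith [cantorLength_pos hc (n + 1)]) (by linarith [hea.1])
    have h2 := scaleWeight_two_pow hc (by positivity : 0 < δ * (r / 4)) m
    have h4 : scaleWeight c r ≤ scaleWeight c (2 ^ m * (δ * (r / 4))) := by
      refine scaleWeight_mono hc ?_
      rw [div_lt_iff₀ hδ] at hm
      nlinarith
    have h5 : κ ≤ Real.exp (-6) * (δ / 8) / 4 ^ m := min_le_right _ _
    have h6 := scaleWeight_mono hc hL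
    have h7 := scaleWeight_nonneg c r
    have h8 := scaleWeight_nonneg c (δ * (r / 4))
    have h9 := scaleWeight_nonneg c (cantorLength c (n + 1))
    calc κ * (r * scaleWeight c r)
        ≤ Real.exp (-6) * (δ / 8) / 4 ^ m * (r * (4 ^ m * scaleWeight c (δ * (r / 4)))) := by
          gcongr
          exact h4.trans h2
      _ = Real.exp (-6) * scaleWeight c (δ * (r / 4)) * (δ * (r / 4) / 2) := by
          field_simp; ring
      _ ≤ Real.exp (-6) * scaleWeight c (cantorLength c (n + 1)) *
          (cantorLength c (n + 1) / 2) := by gcongr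
      _ ≤ _ := h1.trans h3

/-- For `t ≤ 1` monotonicity gives the term `t`, for `t ≥ 1` doubling gives `4 t^3`. The sum serves
both ranges and is, up to a positive factor, a homeomorphism of the half-line. -/
theorem scale_mul_weight_le (hc : ∀ i, 0 < c i ∧ c i < 1) {r₁ r₂ t : ℝ} (h1 : 0 ≤ r₁)
    (h2 : 0 < r₂) (ht : 0 ≤ t) (hle : r₁ ≤ t * r₂) :
    r₁ * scaleWeight c r₁ ≤ (4 * t ^ 3 + t) * (r₂ * scaleWeight c r₂) := by
  have hp1 := scaleWeight_nonneg c r₁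
  have hp2 := scaleWeight_nonneg c r₂
  rcases le_total t 1 with ht1 | ht1
  · have : scaleWeight c r₁ ≤ scaleWeight c r₂ := scaleWeight_mono hc (by nlinarith)
    calc r₁ * scaleWeight c r₁ ≤ t * r₂ * scaleWeight c r₂ := by gcongr
      _ = (0 + t) * (r₂ * scaleWeight c r₂) := by ring
      _ ≤ _ := by gcongr; positivity
  · obtain ⟨m, hm1, hm2⟩ := exists_nat_pow_near ht1 (by norm_num : (1 : ℝ) < 2)
    have h3 : scaleWeight c r₁ ≤ 4 ^ (m + 1) * scaleWeight c r₂ := by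
      refine (scaleWeight_mono hc ?_).trans (scaleWeight_two_pow hc h2 (m + 1))
      exact hle.trans (by gcongr)
    have h4 : (4 : ℝ) ^ (m + 1) ≤ 4 * t ^ 2 := by
      calc (4 : ℝ) ^ (m + 1) = 4 * (2 ^ m) ^ 2 := by
            rw [pow_succ, ← pow_mul, mul_comm m 2, pow_mul]; norm_num; ring
        _ ≤ _ := by gcongr
    calc r₁ * scaleWeight c r₁ ≤ t * r₂ * (4 * t ^ 2 * scaleWeight c r₂) := by
          gcongr
          exact h3.trans (by gcongr)
      _ = (4 * t ^ 3 + 0) * (r₂ * scaleWeight c r₂) := by ring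
      _ ≤ _ := by gcongr

theorem exists_cubic_homeomorph {k : ℝ≥0} (hk : 0 < k) :
    ∃ η : ℝ≥0 ≃ₜ ℝ≥0, ∀ t, η t = k * (4 * t ^ 3 + t) := by
  set f : ℝ≥0 → ℝ≥0 := fun t => k * (4 * t ^ 3 + t) with hf
  have hmono : StrictMono f := by
    intro s t hst
    simp only [hf]
    gcongr
  have hcont : Continuous f := by fun_prop
  have hsurj : Function.Surjective f := by
    intro y
    refine mem_range_of_exists_le_of_exists_ge hcont ⟨0, by simp [hf]⟩ ⟨y / k, ?_⟩
    calc y = k * (0 + y / k) := by rw [zero_add, mul_div_cancel₀ _ hk.ne']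
      _ ≤ _ := by simp only [hf]; gcongr; exact zero_le
  exact ⟨(hmono.orderIsoOfSurjective f hsurj).toHomeomorph, fun t => rfl⟩

theorem isQuasisymmetric_deformation (hc : ∀ i, 0 < c i ∧ c i < 1) {δ : ℝ} (hδ : 0 < δ)
    (hlen : ∀ n, δ * cantorLength c n ≤ cantorLength c (n + 1)) :
    IsQuasisymmetric fun x : middleIntervalCantorSet c => cantorDeformation c x := by
  obtain ⟨κ, hκ, hlow⟩ := exists_le_dist_deformation hc hδ hlen
  have hposd : ∀ x y : middleIntervalCantorSet c, x ≠ y →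
      0 < dist x y * scaleWeight c (dist x y) := fun x y hxy =>
    mul_pos (dist_pos.2 hxy) (scaleWeight_pos hc (dist_pos.2 hxy))
  have hlow' : ∀ x y : middleIntervalCantorSet c, κ * (dist x y * scaleWeight c (dist x y)) ≤
      dist (cantorDeformation c x) (cantorDeformation c y) := fun x y => hlow x x.2 y y.2
  obtain ⟨η, hη⟩ := exists_cubic_homeomorph (k := (κ⁻¹).toNNReal)
    (Real.toNNReal_pos.2 (inv_pos.2 hκ))
  refine ⟨fun x y hxy => ?_, η, fun x y z hxy hyz _ t ht hd => ?_⟩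
  · by_contra hne
    have h1 := hlow' x y
    have h2 := mul_pos hκ (hposd x y hne)
    simp only at hxy
    rw [hxy, dist_self] at h1
    linarith
  · have hyz' : 0 < dist y z := dist_pos.2 hyz
    rw [div_le_iff₀ hyz'] at hd
    have h1 : dist (cantorDeformation c x) (cantorDeformation c y) ≤
        dist x y * scaleWeight c (dist x y) := dist_deformation_le hc x.2 y.2
    have h2 := scale_mul_weight_le hc dist_nonneg hyz' t.coe_nonneg hd
    have h3 := hlow' y z
    have h4 := mul_pos hκ (hposd y z hyz)
    rw [div_le_iff₀ (h4.trans_le h3), hη]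
    push_cast
    rw [Real.coe_toNNReal _ (inv_pos.2 hκ).le]
    calc _ ≤ _ := h1.trans h2
      _ = κ⁻¹ * (4 * (t : ℝ) ^ 3 + t) * (κ * (dist y z * scaleWeight c (dist y z))) := by
          field_simp
      _ ≤ _ := by gcongr

/-- The open ball about 0 whose radius is the shift meets `E` only in the left child `[0, L_{n+1}]`.
Uniform perfectness bounds the shift by `C L_{n+1}`, and `L_n` is the shift plus `L_{n+1}`. -/
theorem exists_length_ratio (hc : ∀ i, 0 < c i ∧ c i < 1)
    (hup : IsUniformlyPerfect (middleIntervalCantorSet c)) :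
    ∃ δ : ℝ, 0 < δ ∧ δ ≤ 1 / 2 ∧ ∀ n, δ * cantorLength c n ≤ cantorLength c (n + 1) := by
  obtain ⟨C, hC, h⟩ := hup
  refine ⟨1 / (C + 1), by positivity, ?_, fun n => ?_⟩
  · exact one_div_le_one_div_of_le (by norm_num) (by linarith)
  have hL := cantorLength_pos hc (n + 1)
  have hs := cantorLength_lt_shift hc n
  have hadd := cantorShift_add c n
  have h0 := left_mem_of_le (Nat.zero_le n) (zero_mem_left c)
  have hsE := left_mem_middleCantor hc (shift_mem_succ h0)
  rw [zero_add] at hsE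
  obtain ⟨⟨w, hwE⟩, hw1, hw2⟩ := h ⟨0, zero_mem_middleCantor hc⟩ (cantorShift c n) (by linarith)
    ⟨⟨_, hsE⟩, Set.mem_univ _, by
      rw [Metric.mem_ball, Subtype.dist_eq, Real.dist_eq, sub_zero, abs_of_pos (by linarith)]
      exact lt_irrefl _⟩
  have hw0 := (middleCantor_subset c hwE).1
  rw [Metric.mem_ball, Subtype.dist_eq, Real.dist_eq, sub_zero, abs_of_nonneg hw0] at hw1 hw2
  rw [not_lt, div_le_iff₀ (by linarith)] at hw2
  have hwL : w ≤ cantorLength c (n + 1) := by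
    rcases interval_subset_children hc h0 hwE ⟨hw0, by linarith⟩ with h | h
    · linarith [h.2]
    · linarith [h.1]
  rw [div_mul_eq_mul_div, one_mul, div_le_iff₀ (by linarith)]
  nlinarith

/-- Factor by factor: `1 - c_j ≥ 2δ` gives `-log(1 - c_j) ≤ c_j/(1 - c_j) ≤ c_j/(2δ)`, and `2^n L_n`
is the product of the `1 - c_j`. -/
theorem exp_neg_sum_le (hc : ∀ i, 0 < c i ∧ c i < 1) {δ : ℝ}
    (hlen : ∀ n, δ * cantorLength c n ≤ cantorLength c (n + 1)) (hδ : 0 < δ) (n : ℕ) :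
    Real.exp (-∑ j ∈ Finset.range n, c j) ≤ (2 ^ n * cantorLength c n) ^ (2 * δ) := by
  induction n with
  | zero => simp [cantorLength]
  | succ n ih =>
    have hL := cantorLength_pos hc n
    obtain ⟨h0, h1⟩ := hc n
    have h2 : 2 * δ ≤ 1 - c n := by
      have := hlen n
      have h3 := two_mul_cantorLength_succ c n
      have : 2 * δ * cantorLength c n ≤ (1 - c n) * cantorLength c n := by linarith
      exact le_of_mul_le_mul_right this hL
    have h3 : Real.exp (-c n) ≤ (1 - c n) ^ (2 * δ) := by
      rw [Real.rpow_def_of_pos (by linarith)]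
      gcongr
      have h4 := Real.one_sub_inv_le_log_of_pos (by linarith : 0 < 1 - c n)
      have h5 : 1 - (1 - c n)⁻¹ = -(c n / (1 - c n)) := by
        field_simp [(by linarith : 1 - c n ≠ 0)]
        ring
      rw [h5] at h4
      have h6 : c n / (1 - c n) * (2 * δ) ≤ c n := by
        rw [div_mul_eq_mul_div, div_le_iff₀ (by linarith)]
        gcongr
      nlinarith
    have h4 : 2 ^ (n + 1) * cantorLength c (n + 1) = 2 ^ n * cantorLength c n * (1 - c n) := by
      rw [pow_succ, mul_assoc, two_mul_cantorLength_succ]; ring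
    rw [Finset.sum_range_succ, neg_add, Real.exp_add, h4,
      Real.mul_rpow (by positivity) (by linarith)]
    gcongr

theorem dimH_middleCantor_pos (hc : ∀ i, 0 < c i ∧ c i < 1) {δ : ℝ} (hδ : 0 < δ)
    (hδ1 : δ ≤ 1 / 2) (hlen : ∀ n, δ * cantorLength c n ≤ cantorLength c (n + 1)) :
    0 < dimH (middleIntervalCantorSet c) := by
  have hpow : ∀ n, δ ^ n ≤ cantorLength c n := by
    intro n
    induction n with
    | zero => simp [cantorLength]
    | succ n ih =>
      rw [pow_succ']
      exact (mul_le_mul_of_nonneg_left ih hδ.le).trans (hlen n)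
  have hs : 0 < Real.logb δ (1 / 2) :=
    Real.logb_pos_of_base_lt_one hδ (by linarith) (by norm_num) (by norm_num)
  refine (ENNReal.ofReal_pos.2 hs).trans_le
    (le_dimH_middleCantor hc hs.le (Eventually.of_forall fun n => ?_))
  calc (1 : ℝ) = 2 ^ n * (1 / 2) ^ n := by rw [← mul_pow]; norm_num
    _ = 2 ^ n * (δ ^ n) ^ Real.logb δ (1 / 2) := by
        rw [← Real.rpow_pow_comm hδ.le, Real.rpow_logb hδ (by linarith) (by norm_num)]
    _ ≤ _ := by gcongr; exact hpow n

theorem dimH_deformation_lt (hc : ∀ i, 0 < c i ∧ c i < 1) {δ : ℝ} (hδ : 0 < δ)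
    (hδ1 : δ ≤ 1 / 2) (hlen : ∀ n, δ * cantorLength c n ≤ cantorLength c (n + 1))
    (hdim : dimH (middleIntervalCantorSet c) < 1) :
    dimH (cantorDeformation c '' middleIntervalCantorSet c) <
      dimH (middleIntervalCantorSet c) := by
  have htop : dimH (middleIntervalCantorSet c) ≠ ∞ := hdim.ne_top
  set d := (dimH (middleIntervalCantorSet c)).toReal with hd
  have hdE : ENNReal.ofReal d = dimH (middleIntervalCantorSet c) := ENNReal.ofReal_toReal htop
  have hd0 : 0 < d := ENNReal.toReal_pos (dimH_middleCantor_pos hc hδ hδ1 hlen).ne' htop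
  have hd1 : d < 1 := by
    rw [← hdE, ENNReal.ofReal_lt_one] at hdim
    exact hdim
  set β := 2 * δ with hβ
  have hβ0 : 0 < β := by positivity
  have hβ1 : β ≤ 1 := by linarith
  -- As `s` decreases to `d`, `s / v` tends to `d / (1 + β (1 - d)) < d`; this `s > d` is close
  -- enough to keep `s / v < d`.
  set s := d + d * β * (1 - d) / 2 with hs
  have hsd : d < s := by
    have : 0 < d * β * (1 - d) := mul_pos (mul_pos hd0 hβ0) (by linarith)
    linarith
  have hdβ : d * β < 1 := by nlinarith
  have hs1 : s < 1 := by nlinarith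
  have hs0 : 0 < s := hd0.trans hsd
  set v := 1 + β * (1 - s) with hv
  have hv0 : 0 < v := by nlinarith
  have hsv : s / v < d := by
    rw [div_lt_iff₀ hv0]
    have : d * v - s = d * β * (1 - d) * (1 / 2 - d * β / 2) := by rw [hv, hs]; ring
    have h2 : 0 < d * β * (1 - d) * (1 / 2 - d * β / 2) :=
      mul_pos (mul_pos (mul_pos hd0 hβ0) (by linarith)) (by linarith)
    linarith
  -- Otherwise the lower estimate would give dimension at least `s > d`.
  have hfreq : ∃ᶠ n in atTop, 2 ^ n * cantorLength c n ^ s ≤ 1 := by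
    by_contra h
    rw [not_frequently] at h
    have := le_dimH_middleCantor hc hs0.le (h.mono fun n hn => (not_le.1 hn).le)
    rw [← hdE, ENNReal.ofReal_le_ofReal_iff hd0.le] at this
    linarith
  have hL := cantorLength_pos hc
  have hM0 : ∀ n, 0 ≤ cantorLength c n * scaleWeight c (cantorLength c n) := fun n =>
    mul_nonneg (hL n).le (scaleWeight_nonneg _ _)
  have hle := dimH_image_le_of_diam (c := c) (cantorDeformation c)
    (M := fun n => cantorLength c n * scaleWeight c (cantorLength c n)) hM0
    (squeeze_zero hM0 (fun n => mul_le_of_le_one_right (hL n).le (scaleWeight_le_one _ _))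
      (tendsto_cantorLength hc))
    (fun n a _ x hx y hy hxa hya => by
      have h1 : dist x y ≤ cantorLength c n := by
        rw [Real.dist_eq, abs_le]
        constructor <;> linarith [hxa.1, hxa.2, hya.1, hya.2]
      refine (dist_deformation_le hc hx hy).trans ?_
      have := hL n
      exact mul_le_mul h1 (scaleWeight_mono hc h1) (scaleWeight_nonneg _ _) this.le)
    (s := s / v) (by positivity) (hfreq.mono fun n hn => by
      have hu0 : (0 : ℝ) < 2 ^ n := by positivity
      have h1 : cantorLength c n ≤ ((2 : ℝ) ^ n) ^ (-(1 / s)) := by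
        have h2 : cantorLength c n ^ s ≤ ((2 : ℝ) ^ n)⁻¹ := by
          rw [← one_div, le_div_iff₀' hu0]; exact hn
        have h3 := Real.rpow_le_rpow (Real.rpow_nonneg (hL n).le s) h2
          (by positivity : 0 ≤ 1 / s)
        rwa [← Real.rpow_mul (hL n).le, mul_one_div_cancel hs0.ne', Real.rpow_one,
          Real.inv_rpow hu0.le, ← Real.rpow_neg hu0.le] at h3
      -- With `u = 2^n` and `L_n ≤ u^{-1/s}`, the new length is at most `L_n (u L_n)^β ≤ u^{-v/s}`.
      have h2 : cantorLength c n * scaleWeight c (cantorLength c n) ≤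
          ((2 : ℝ) ^ n) ^ (-(v / s)) := by
        calc cantorLength c n * scaleWeight c (cantorLength c n)
            ≤ cantorLength c n * (2 ^ n * cantorLength c n) ^ β := by
              have := hL n
              gcongr
              exact (scaleWeight_cantorLength_le hc n).trans (exp_neg_sum_le hc hlen hδ n)
          _ ≤ ((2 : ℝ) ^ n) ^ (-(1 / s)) * (2 ^ n * ((2 : ℝ) ^ n) ^ (-(1 / s))) ^ β := by
              have := hL n
              gcongr
          _ = _ := by
              rw [Real.mul_rpow hu0.le (by positivity), ← Real.rpow_mul hu0.le,
                ← Real.rpow_add hu0, ← Real.rpow_add hu0]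
              congr 1
              rw [hv]
              field_simp
              ring
      calc _ ≤ (2 : ℝ) ^ n * (((2 : ℝ) ^ n) ^ (-(v / s))) ^ (s / v) := by
            have := hM0 n
            gcongr
        _ = 1 := by
            rw [← Real.rpow_mul hu0.le, neg_mul, div_mul_div_cancel₀ hs0.ne', div_self hv0.ne',
              Real.rpow_neg_one, mul_inv_cancel₀ hu0.ne'])
  refine hle.trans_lt ?_
  rw [← hdE]
  exact (ENNReal.ofReal_lt_ofReal_iff hd0).2 hsv

end Deformation

/-! ### Assembling the theorem -/

theorem isQuasisymmetric_id (X : Type*) [MetricSpace X] : IsQuasisymmetric (id : X → X) :=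
  ⟨Function.injective_id, Homeomorph.refl _, fun _ _ _ _ _ _ _ _ h => h⟩

theorem dimH_univ_subtype (E : Set ℝ) : dimH (Set.univ : Set E) = dimH E := by
  rw [← isometry_subtype_coe.dimH_image, Set.image_univ, Subtype.range_coe]

theorem one_le_dimH_range_of_extension {c : ℕ → ℝ} (hc : ∀ i, 0 < c i ∧ c i < 1)
    (hdim : dimH (middleIntervalCantorSet c) = 1) {X Y : Type*} [MetricSpace X] [MetricSpace Y]
    {ι : middleIntervalCantorSet c → X} {F : X → Y} {f : middleIntervalCantorSet c → Y}
    (hX : IsUniformlyPerfect X) (hι : Isometry ι) (hF : IsQuasisymmetric F)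
    (hf : ∀ x, F (ι x) = f x) : 1 ≤ dimH (Set.range f) := by
  classical
  set g : ℝ → Y := fun x => if h : x ∈ middleIntervalCantorSet c then f ⟨x, h⟩ else
    f ⟨0, zero_mem_middleCantor hc⟩ with hg
  have hgf : ∀ x (h : x ∈ middleIntervalCantorSet c), g x = F (ι ⟨x, h⟩) := fun x h => by
    simp only [hg, dif_pos h, hf]
  have hrange : g '' middleIntervalCantorSet c = Set.range f := by
    ext y
    constructor
    · rintro ⟨x, hx, rfl⟩
      exact ⟨⟨x, hx⟩, by rw [hgf x hx, hf]⟩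
    · rintro ⟨⟨x, hx⟩, rfl⟩
      exact ⟨x, hx, by rw [hgf x hx, hf]⟩
  have hdist : ∀ x (hx : x ∈ middleIntervalCantorSet c) y (hy : y ∈ middleIntervalCantorSet c),
      dist (ι ⟨x, hx⟩) (ι ⟨y, hy⟩) = dist x y := fun x hx y hy => hι.dist_eq _ _
  have hne : ∀ x (hx : x ∈ middleIntervalCantorSet c) y (hy : y ∈ middleIntervalCantorSet c),
      x ≠ y → ι ⟨x, hx⟩ ≠ ι ⟨y, hy⟩ := fun x hx y hy h =>
    hι.injective.ne fun h' => h (congrArg Subtype.val h')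
  obtain ⟨A, hA1, K, hA⟩ := hF.exists_growth hX
  rw [← hrange]
  refine one_le_dimH_image hc hdim hA1 (K := K) ?_ ?_ ?_
  · intro x hx y hy z hz hyz t ht hd
    rw [hgf x hx, hgf y hy, hgf z hz]
    exact hA _ _ _ (hne y hy z hz hyz) t ht (by rw [hdist, hdist]; exact hd)
  · intro ε hε
    obtain ⟨τ, hτ, h⟩ := hF.exists_small hε
    refine ⟨τ, hτ, fun x hx y hy z hz hyz hd => ?_⟩
    rw [hgf x hx, hgf y hy, hgf z hz]
    exact h _ _ _ (hne y hy z hz hyz) (by rw [hdist, hdist]; exact hd)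
  · intro x hx y hy h
    rw [hgf x hx, hgf y hy] at h
    exact congrArg Subtype.val (hι.injective (hF.1 h))

theorem corollary1 (E : Set ℝ) (hE : IsMiddleIntervalCantorSet E) :
    (IsUniformlyPerfect E → (IsMinimalForConformalDim E ↔ dimH E = 1)) ∧
    (dimH E = 1 →
      ∀ (X : Type*) (Y : Type*) [MetricSpace X] [MetricSpace Y] (ι : E → X) (F : X → Y)
        (f : E → Y), IsUniformlyPerfect X → Isometry ι → IsQuasisymmetric F →
        (∀ x : E, F (ι x) = f x) → 1 ≤ dimH (Set.range f)) := by
  obtain ⟨c, hc, rfl⟩ := hE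
  refine ⟨fun hup => ?_, fun hdim X Y _ _ ι F f hX hι hF hf =>
    one_le_dimH_range_of_extension hc hdim hX hι hF hf⟩
  rw [IsMinimalForConformalDim, dimH_univ_subtype]
  constructor
  · intro hmin
    by_contra hne
    have hle : dimH (middleIntervalCantorSet c) ≤ 1 :=
      (dimH_mono (Set.subset_univ _)).trans_eq Real.dimH_univ
    obtain ⟨δ, hδ, hδ1, hlen⟩ := exists_length_ratio hc hup
    have hlt := dimH_deformation_lt hc hδ hδ1 hlen (lt_of_le_of_ne hle hne)
    have hconf : conformalDim (middleIntervalCantorSet c) ≤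
        dimH (Set.range fun x : middleIntervalCantorSet c => cantorDeformation c x) :=
      sInf_le ⟨ℝ, inferInstance, _, isQuasisymmetric_deformation hc hδ hlen, rfl⟩
    rw [← Set.image_eq_range, hmin] at hconf
    exact absurd hlt (not_lt.2 hconf)
  · intro hdim
    rw [hdim]
    refine le_antisymm (sInf_le ⟨_, inferInstance, id, isQuasisymmetric_id _, ?_⟩)
      (le_sInf ?_)
    · rw [Set.range_id, dimH_univ_subtype, hdim]
    · rintro _ ⟨Y, _, f, hf, rfl⟩
      -- Here the ambient uniformly perfect space is `E` itself, so every quasisymmetric map is its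
      -- own extension.
      exact one_le_dimH_range_of_extension hc hdim hup isometry_id hf fun _ => rfl
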